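/- Let $n\ge 2$ and let $V:\mathbb{R}^n\to\mathbb{C}$ be measurable. Write $L^2(|V|)$ and $L^2(|V|^{-1})$ for the weighted spaces with norms $\|u\|_{L^2(|V|)}^2=\int|u|^2|V|\,dx$ and $\|f\|_{L^2(|V|^{-1})}^2=\int|f|^2|V|^{-1}dx$ (with $1/0=\infty$, so that elements of $L^2(|V|^{-1})$ vanish a.e. where $V=0$), $\langle u,g\rangle=\int u\,\overline{g}\,dx$, $R_0(z)=(-\Delta-z)^{-1}$ for the free resolvent on $L^2(\mathbb{R}^n)$, and $\widehat f(\xi)=\int e^{-ix\cdot\xi}f(x)\,dx$. Let $d\sigma_r$ be the surface measure on the sphere $\{|\xi|=r\}$ and $\widehat{d\sigma_r}(x)=\int e^{-ix\cdot\xi}d\sigma_r(\xi)$. Suppose that, for some constant $C(V)\ge 0$, the resolvent estimate $$\|R_0(z)f\|_{L^2(|V|)}\le C(V)\|f\|_{L^2(|V|^{-1})}\qquad (f\in L^2\cap L^2(|V|^{-1}))$$ holds for all $z\in\mathbb{C}\setminus\mathbb{R}$. Then $R_0(z)$, $z\in\mathbb{C}\setminus\mathbb{R}$, extends uniquely from $L^2\cap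 L^2(|V|^{-1})$ to a bounded operator $L^2(|V|^{-1})\to L^2(|V|)$, still denoted by $R_0(z)$, and for every $\lambda>0$ and each choice of sign there is a bounded linear operator $R_0(\lambda\pm i0):L^2(|V|^{-1})\to L^2(|V|)$ such that: 1. for all $f,g\in L^2(|V|^{-1})$, $$\lim_{\varepsilon\to0+}\langle R_0(\lambda\pm i\varepsilon)f,g\rangle=\langle R_0(\lambda\pm i0)f,g\rangle;$$ 2. $\|R_0(\lambda\pm i0)f\|_{L^2(|V|)}\le C(V)\|f\|_{L^2(|V|^{-1})}$ for all $f\in L^2(|V|^{-1})$, with the same constant $C(V)$; 3. for all $f\in L^2(|V|^{-1})$, as an identity in $L^2(|V|)$, $$R_0(\lambda\pm i0)f=(2\pi)^{-n}\Big[\pm\frac{i\pi}{2\sqrt\lambda}\,\widehat{d\sigma_{\sqrt\lambda}}*f+\mathrm{p.v.}\int_{\mathbb{R}^n}e^{ix\cdot\xi}\frac{\widehat f(\xi)}{|\xi|^2-\lambda}\,d\xi\Big].$$ Here the convolution converges absolutely at every point and lies in $L^2(|V|)$. For $\delta>0$, the truncated operator $P_\delta f=(2\pi)^{-n}\int_{||\xi|^2-\lambda|>\delta}e^{ix\cdot\xi}\frac{\widehat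 f(\xi)}{|\xi|^2-\lambda}d\xi$, defined on $L^2$, extends uniquely from $L^2\cap L^2(|V|^{-1})$ to a bounded operator $L^2(|V|^{-1})\to L^2(|V|)$; the principal value term (with its factor $(2\pi)^{-n}$) is the element $w\in L^2(|V|)$ with $\langle P_\delta f,g\rangle\to\langle w,g\rangle$ as $\delta\to0+$ for all $g\in L^2(|V|^{-1})$. -/

import Mathlib

open MeasureTheory Filter Topology
open scoped ContDiff ENNReal NNReal ComplexConjugate FourierTransform SchwartzMap Laplacian

noncomputable section

/-- `L²(ℝⁿ; ℂ)`. -/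
abbrev L2 (n : ℕ) : Type := Lp ℂ 2 (volume : Measure (EuclideanSpace ℝ (Fin n)))

/-- The measure `w(x) dx` on `ℝⁿ`, for a weight `w` with values in `[0, ∞]`. -/
abbrev weightMeasure {n : ℕ} (w : EuclideanSpace ℝ (Fin n) → ℝ≥0∞) :
    Measure (EuclideanSpace ℝ (Fin n)) :=
  volume.withDensity w

/-- The weighted space `L²(|V|)`, that is, `‖u‖² = ∫ |u|² |V| dx`. -/
abbrev L2Weight {n : ℕ} (V : EuclideanSpace ℝ (Fin n) → ℂ) : Type :=
  Lp ℂ 2 (weightMeasure (fun x => ‖V x‖ₑ))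

/-- The weighted space `L²(|V|⁻¹)`, that is, `‖f‖² = ∫ |f|² |V|⁻¹ dx`, where `0⁻¹ = ∞`
(so that its elements vanish almost everywhere on `{V = 0}`). -/
abbrev L2InvWeight {n : ℕ} (V : EuclideanSpace ℝ (Fin n) → ℂ) : Type :=
  Lp ℂ 2 (weightMeasure (fun x => ‖V x‖ₑ⁻¹))

/-- The pairing `⟨u, g⟩ = ∫ u(x) conj(g(x)) dx`. -/
def pairing {n : ℕ} (u g : EuclideanSpace ℝ (Fin n) → ℂ) : ℂ :=
  ∫ x, u x * conj (g x)

open Classical in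
/-- The Fourier multiplier operator with symbol `m` on `L²(ℝⁿ)`,
`f ↦ (2π)⁻ⁿ ∫ e^{i x·ξ} m(ξ) f̂(ξ) dξ` where `f̂(ξ) = ∫ e^{-i x·ξ} f(x) dx`.
Mathlib's transform `𝓕` has the kernel `e^{-2π i x·ξ}`, whence the dilation of `m` by `2π`.
(The value is `0` if `m f̂` is not in `L²`; this does not occur for bounded measurable `m`.) -/
def fourierMultiplierL2 {n : ℕ} (m : EuclideanSpace ℝ (Fin n) → ℂ) (f : L2 n) : L2 n :=
  if h : MemLp (fun ξ => m ((2 * Real.pi) • ξ) * (𝓕 f : L2 n) ξ) 2 volume then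
    𝓕⁻ (h.toLp _ : L2 n)
  else 0

/-- The free resolvent `R₀(z) = (-Δ - z)⁻¹` on `L²(ℝⁿ)`, for `z ∉ ℝ`. -/
def freeResolvent {n : ℕ} (z : ℂ) : L2 n → L2 n :=
  fourierMultiplierL2 (fun ξ => 1 / ((‖ξ‖ ^ 2 : ℝ) - z : ℂ))

/-- The truncation `f ↦ (2π)⁻ⁿ ∫_{| |ξ|² - lam | > δ} e^{i x·ξ} f̂(ξ) / (|ξ|² - lam) dξ` of the
singular integral at height `δ > 0`. -/
def truncatedSingular {n : ℕ} (lam δ : ℝ) : L2 n → L2 n :=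
  fourierMultiplierL2 (fun ξ =>
    if δ < |‖ξ‖ ^ 2 - lam| then 1 / ((‖ξ‖ ^ 2 - lam : ℝ) : ℂ) else 0)

/-- `T : L²(|V|⁻¹) → L²(|V|)` is a bounded operator that agrees with `A` on
`L²(ℝⁿ) ∩ L²(|V|⁻¹)`. -/
def IsWeightedExtension {n : ℕ} (V : EuclideanSpace ℝ (Fin n) → ℂ) (A : L2 n → L2 n)
    (T : L2InvWeight V →L[ℂ] L2Weight V) : Prop :=
  ∀ (f : L2InvWeight V) (hf : MemLp f 2 volume),
    T f =ᵐ[weightMeasure (fun x => ‖V x‖ₑ)] (A (hf.toLp f) : EuclideanSpace ℝ (Fin n) → ℂ)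

open Classical in
/-- The bounded extension of `A` from `L²(ℝⁿ) ∩ L²(|V|⁻¹)` to an operator
`L²(|V|⁻¹) → L²(|V|)` (and `0` if there is none). -/
def weightedExtension {n : ℕ} (V : EuclideanSpace ℝ (Fin n) → ℂ) (A : L2 n → L2 n) :
    L2InvWeight V →L[ℂ] L2Weight V :=
  if h : ∃ T, IsWeightedExtension V A T then h.choose else 0

/-- The surface measure `dσ_r` on the sphere of radius `r` about the origin of `ℝⁿ`. -/
def sphereMeasure (n : ℕ) (r : ℝ) : Measure (EuclideanSpace ℝ (Fin n)) :=
  ENNReal.ofReal (r ^ (n - 1)) •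
    ((volume : Measure (EuclideanSpace ℝ (Fin n))).toSphere.map
      (fun v : Metric.sphere (0 : EuclideanSpace ℝ (Fin n)) 1 =>
        r • (v : EuclideanSpace ℝ (Fin n))))

/-- The Fourier transform `x ↦ ∫ e^{-i x·ξ} dσ_r(ξ)` of the surface measure. -/
def sphereMeasureHat {n : ℕ} (r : ℝ) (x : EuclideanSpace ℝ (Fin n)) : ℂ :=
  ∫ ξ, Complex.exp (-Complex.I * (inner ℝ x ξ : ℝ)) ∂(sphereMeasure n r)

/-- The symbol of `-Δ - z` does not vanish, for `z ∉ ℝ`. -/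
theorem symbol_ne_zero {z : ℂ} (hz : z.im ≠ 0) (t : ℝ) : (t : ℂ) - z ≠ 0 := by
  intro h
  apply hz
  have := congrArg Complex.im h
  simpa using this

/-- `-Δ - z` acts on the Fourier side as multiplication by `|ξ|² - z`. -/
theorem neg_laplacian_sub_eq_iff {n : ℕ} (z : ℂ) (f u : L2 n) :
    -Δ (u : 𝓢'(EuclideanSpace ℝ (Fin n), ℂ)) - z • (u : 𝓢'(EuclideanSpace ℝ (Fin n), ℂ)) =
        (f : 𝓢'(EuclideanSpace ℝ (Fin n), ℂ)) ↔
      (fun ξ => (((‖(2 * Real.pi) • ξ‖ ^ 2 : ℝ) : ℂ) - z) * (𝓕 u : L2 n) ξ)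
        =ᵐ[volume] (𝓕 f : L2 n) := by
  set E := EuclideanSpace ℝ (Fin n)
  set p : E → ℂ := fun ξ => (((‖(2 * Real.pi) • ξ‖ ^ 2 : ℝ) : ℂ) - z) with hp
  have hpe : p = fun ξ => ((2 * Real.pi : ℂ) ^ 2 * Complex.ofReal (‖ξ‖ ^ 2)) - z := by
    funext ξ
    simp [hp, norm_smul, abs_of_pos Real.pi_pos, mul_pow]
  have hg0 : (fun x : E => Complex.ofReal (‖x‖ ^ 2)).HasTemperateGrowth := by fun_prop
  have hgp : p.HasTemperateGrowth := by rw [hpe]; fun_prop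
  have key : 𝓕 (-Δ (u : 𝓢'(E, ℂ)) - z • (u : 𝓢'(E, ℂ))) =
      TemperedDistribution.smulLeftCLM ℂ p ((𝓕 u : L2 n) : 𝓢'(E, ℂ)) := by
    rw [TemperedDistribution.laplacian_eq_fourierMultiplierCLM,
      ← Lp.fourier_toTemperedDistribution_eq]
    have hpp : p = (((2 * Real.pi : ℂ) ^ 2) • (fun x : E => Complex.ofReal (‖x‖ ^ 2)))
        - (z • fun _ => (1 : ℂ)) := by
      rw [hpe]; funext ξ; simp
    rw [hpp, TemperedDistribution.smulLeftCLM_sub (by fun_prop) (by fun_prop),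
      TemperedDistribution.smulLeftCLM_smul hg0,
      TemperedDistribution.smulLeftCLM_smul (by fun_prop)]
    have h2 : ((2 * Real.pi : ℂ) ^ 2) = (((2 * Real.pi) ^ 2 : ℝ) : ℂ) := by push_cast; rfl
    rw [neg_smul, neg_neg, TemperedDistribution.fourierMultiplierCLM_apply, ← Complex.coe_smul, ← h2]
    change FourierTransform.fourierCLM ℂ 𝓢'(E, ℂ) _ = _
    rw [map_sub, map_smul, map_smul]
    simp only [FourierTransform.fourierCLM_apply]
    rw [FourierTransform.fourier_fourierInv_eq, sub_apply, smul_apply, smul_apply,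
      TemperedDistribution.smulLeftCLM_const, one_smul]
  have hinj : ∀ a b : 𝓢'(E, ℂ), a = b ↔ 𝓕 a = 𝓕 b := fun a b =>
    (FourierTransform.fourierEquiv ℂ 𝓢'(E, ℂ)).injective.eq_iff.symm
  rw [hinj, key, Lp.fourier_toTemperedDistribution_eq]
  change _ ↔ (fun ξ => p ξ * (𝓕 u : L2 n) ξ) =ᵐ[volume] (𝓕 f : L2 n)
  clear_value p
  have hpc : Continuous p := hgp.1.continuous
  have hU : LocallyIntegrable (𝓕 u : L2 n) volume :=
    (Lp.memLp (𝓕 u : L2 n)).locallyIntegrable (by norm_num)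
  have hF : LocallyIntegrable (𝓕 f : L2 n) volume :=
    (Lp.memLp (𝓕 f : L2 n)).locallyIntegrable (by norm_num)
  have hpU : LocallyIntegrable (fun ξ => p ξ * (𝓕 u : L2 n) ξ) volume := by
    have := (locallyIntegrableOn_univ.2 hU).continuousOn_smul (𝕜 := ℂ) isOpen_univ.isLocallyClosed
      hpc.continuousOn
    simpa [locallyIntegrableOn_univ] using this
  constructor
  · intro h
    refine ae_eq_of_integral_contDiff_smul_eq hpU hF fun g hg hgc => ?_
    have hgc' : HasCompactSupport (fun x => (g x : ℂ)) := hgc.comp_left (g := Complex.ofReal) rfl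
    have hg' : ContDiff ℝ ∞ (fun x => (g x : ℂ)) := Complex.ofRealCLM.contDiff.comp hg
    have h2 := congrArg (fun T => T (hgc'.toSchwartzMap hg')) h
    simp only [TemperedDistribution.smulLeftCLM_apply_apply, Lp.toTemperedDistribution_apply,
      SchwartzMap.smulLeftCLM_apply_apply hgp] at h2
    simpa [mul_assoc, mul_left_comm, mul_comm] using h2
  · intro h
    ext φ
    simp only [TemperedDistribution.smulLeftCLM_apply_apply, Lp.toTemperedDistribution_apply,
      SchwartzMap.smulLeftCLM_apply_apply hgp]
    refine integral_congr_ae ?_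
    filter_upwards [h] with ξ hξ
    rw [← hξ]
    simp only [smul_eq_mul]
    ring


/-- `freeResolvent z` is the inverse of `-Δ - z`, with `Δ` taken in the sense of (tempered)
distributions: for `u, f ∈ L²(ℝⁿ)`, `u = R₀(z) f` if and only if `-Δ u - z u = f`. -/
theorem freeResolvent_eq_iff {n : ℕ} {z : ℂ} (hz : z.im ≠ 0) (f u : L2 n) :
    u = freeResolvent z f ↔
      -Δ (u : 𝓢'(EuclideanSpace ℝ (Fin n), ℂ)) - z • (u : 𝓢'(EuclideanSpace ℝ (Fin n), ℂ)) =
        (f : 𝓢'(EuclideanSpace ℝ (Fin n), ℂ)) := by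
  have hmem : MemLp (fun ξ : EuclideanSpace ℝ (Fin n) =>
      (1 / (((‖(2 * Real.pi) • ξ‖ ^ 2 : ℝ) : ℂ) - z)) * (𝓕 f : L2 n) ξ) 2 volume := by
    refine (Lp.memLp (𝓕 f : L2 n)).of_le_mul (c := |z.im|⁻¹) ?_ (ae_of_all _ fun ξ => ?_)
    · refine AEStronglyMeasurable.mul ?_ (Lp.aestronglyMeasurable _)
      refine Continuous.aestronglyMeasurable ?_
      exact Continuous.div continuous_const (by fun_prop) fun ξ => symbol_ne_zero hz _
    · rw [norm_mul, norm_div, norm_one, one_div]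
      refine mul_le_mul_of_nonneg_right ?_ (norm_nonneg _)
      refine inv_anti₀ (abs_pos.2 hz) ?_
      refine le_trans (le_of_eq ?_) (Complex.abs_im_le_norm _)
      rw [Complex.sub_im, Complex.ofReal_im, zero_sub, abs_neg]
  have hR : freeResolvent z f = 𝓕⁻ (hmem.toLp _ : L2 n) := by
    unfold freeResolvent fourierMultiplierL2
    exact dif_pos hmem
  rw [neg_laplacian_sub_eq_iff, hR]
  have h1 : u = 𝓕⁻ (hmem.toLp _ : L2 n) ↔ (𝓕 u : L2 n) = hmem.toLp _ := by
    constructor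
    · intro h
      rw [h, FourierTransform.fourier_fourierInv_eq]
    · intro h
      rw [← h, FourierTransform.fourierInv_fourier_eq]
  rw [h1, Lp.ext_iff]
  constructor
  · intro h
    filter_upwards [h, hmem.coeFn_toLp] with ξ h2 h3
    rw [h2, h3, ← mul_assoc, mul_one_div_cancel (symbol_ne_zero hz _), one_mul]
  · intro h
    filter_upwards [h, hmem.coeFn_toLp] with ξ h2 h3
    rw [h3, ← h2, ← mul_assoc, one_div_mul_cancel (symbol_ne_zero hz _), one_mul]

end

/-! ### Limits of singular kernels on the real line -/

/-! Everything is read off from the spectral density of `-Δ`. For test functions `f`, `g`, Parseval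
and polar coordinates give `⟨m(-Δ) f, g⟩ = ∫ m(t) G(t) dt`, where `G = spectralDensity f g` is an
explicit multiple of the integral of `f̂ conj ĝ` over the sphere of radius `√t`
(`pairing_fourierMultiplierL2_eq_integral`). This `G` is integrable, and the finite first moments of
`f` and `g` make it Lipschitz at each `λ > 0` (`isBigO_spectralDensity`).

The symbol of `R₀(λ ± iε)` is the conjugate Poisson kernel plus `± i` times the Poisson kernel. The
difference of the two resolvents isolates the Poisson integral, which tends to `π G(λ)`; the
resolvent estimate therefore gives `π |G(λ)| ≤ C ‖f‖ ‖g‖`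
(`ResolventEstimate.norm_spectralDensity_le`). This is a weighted bound for restriction to spheres,
uniform in `λ` for the density `G`. The half-sum isolates the conjugate Poisson integral, which
differs from the truncated singular integral by a dilated odd integrable kernel. Since `G` is
bounded, that error is bounded as well, so the truncations are bounded by `2C`; since the kernel is
odd, the error tends to `0`. The principal value exists by the Lipschitz property, and the matrix
elements of the resolvents tend to `± iπ G(λ)` plus the principal value
(`ResolventEstimate.exists_tendsto_pairing`).

The rest is functional analysis. Multiplication by `|V|` is a unitary map from `L²(|V|)` to
`L²(|V|⁻¹)` that turns the pairing into an inner product. Test functions are dense, so uniform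
bounds and convergence on them yield weak limits (`exists_weak_limit`), with the bound `C`
inherited. The restriction bound also places the translates of the transform of the surface measure
in `L²(|V|)`, whence the absolute convergence of the convolution; Fatou then bounds it in `L²(|V|)`
(`eLpNorm_sphereConv_le`). The formula for the limit is checked on test functions. -/

theorem tendsto_integral_poissonKernel {G : ℝ → ℂ} (hG : Integrable G) {a : ℝ}
    (hc : ContinuousAt G a) :
    Tendsto (fun ε : ℝ => ∫ t, ((ε / ((t - a) ^ 2 + ε ^ 2) : ℝ) : ℂ) * G t) (𝓝[>] 0)
      (𝓝 (Real.pi * G a)) := by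
  -- The Poisson kernel is `π` times the Cauchy probability density dilated by `ε⁻¹ → ∞`. The two
  -- remaining goals are its total mass and its decay faster than `1 / |x|`.
  have h := tendsto_integral_comp_smul_smul_of_integrable' (μ := (volume : Measure ℝ))
    (φ := fun x : ℝ => Real.pi⁻¹ * (1 + x ^ 2)⁻¹) (fun x => by positivity) ?_ ?_ hG hc
  · have h2 := (h.comp tendsto_inv_nhdsGT_zero).const_mul (Real.pi : ℂ)
    refine h2.congr' ?_
    filter_upwards [self_mem_nhdsWithin] with ε (hε : 0 < ε)
    simp only [Function.comp_apply, ← integral_const_mul]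
    refine integral_congr_ae (ae_of_all _ fun t => ?_)
    simp only [Module.finrank_self, pow_one, smul_eq_mul, Complex.real_smul, ← mul_assoc]
    congr 1
    rw [← Complex.ofReal_mul]
    congr 1
    have : 0 < (t - a) ^ 2 + ε ^ 2 := by positivity
    have h3 : 0 < 1 + (ε⁻¹ * (a - t)) ^ 2 := by positivity
    have := Real.pi_pos
    field_simp
    ring
  · rw [integral_const_mul, integral_univ_inv_one_add_sq, inv_mul_cancel₀ Real.pi_ne_zero]
  · have h1 : Tendsto (fun x : ℝ => Real.pi⁻¹ * (‖x‖)⁻¹) (Bornology.cobounded ℝ) (𝓝 0) := by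
      simpa using (tendsto_norm_cobounded_atTop (E := ℝ)).inv_tendsto_atTop.const_mul (Real.pi⁻¹)
    refine squeeze_zero (fun x => by positivity) (fun x => ?_) h1
    simp only [Module.finrank_self, pow_one]
    rw [mul_left_comm]
    refine mul_le_mul_of_nonneg_left ?_ (by positivity)
    rcases eq_or_ne x 0 with rfl | hx
    · simp
    have hx' : 0 < ‖x‖ := norm_pos_iff.2 hx
    have : x ^ 2 = ‖x‖ ^ 2 := by simp
    rw [this, ← div_eq_mul_inv, div_le_iff₀ (by positivity)]
    field_simp
    linarith

/-- The kernel of the truncated Hilbert transform minus that of the conjugate Poisson integral. -/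
noncomputable def oddKernel (t : ℝ) : ℝ := (if 1 < |t| then 1 / t else 0) - t / (1 + t ^ 2)

/-- For `|t| > 1` the two tails `1 / t` cancel and leave `1 / (t (1 + t²))`; for `|t| ≤ 1` only the
bounded term is present. -/
theorem abs_oddKernel_le (t : ℝ) : |oddKernel t| ≤ (1 + t ^ 2)⁻¹ := by
  unfold oddKernel
  have hp : 0 < 1 + t ^ 2 := by positivity
  split_ifs with h
  · have ht : t ≠ 0 := by rintro rfl; simp at h; linarith
    have : 1 / t - t / (1 + t ^ 2) = t⁻¹ * (1 + t ^ 2)⁻¹ := by field_simp; ring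
    rw [this, abs_mul, abs_inv, abs_of_pos (inv_pos.2 hp)]
    exact mul_le_of_le_one_left (by positivity) (inv_le_one_of_one_le₀ h.le)
  · rw [zero_sub, abs_neg, abs_div, abs_of_pos hp, div_eq_mul_inv]
    exact mul_le_of_le_one_left (by positivity) (not_lt.1 h)

theorem oddKernel_neg (t : ℝ) : oddKernel (-t) = -oddKernel t := by
  unfold oddKernel
  simp only [abs_neg, neg_sq]
  split_ifs <;> ring

theorem measurable_oddKernel : Measurable oddKernel :=
  (Measurable.ite (measurableSet_lt measurable_const measurable_id.abs) (by fun_prop)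
    measurable_const).sub (by fun_prop)

theorem integrable_oddKernel : Integrable oddKernel :=
  integrable_inv_one_add_sq.mono' measurable_oddKernel.aestronglyMeasurable
    (ae_of_all _ fun t => by simpa using abs_oddKernel_le t)

theorem integral_eq_zero_of_odd {E : Type*} [NormedAddCommGroup E] [NormedSpace ℝ E] {k : ℝ → E}
    (hk : ∀ t, k (-t) = -k t) : ∫ t, k t = 0 := by
  have h := integral_neg_eq_self k volume
  simp only [hk, integral_neg] at h
  have h2 : (2 : ℝ) • ∫ t, k t = 0 := by
    rw [two_smul]; nth_rewrite 1 [← h]; simp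
  simpa using h2

theorem integral_abs_oddKernel_le : ∫ t, |oddKernel t| ≤ Real.pi := by
  rw [← integral_univ_inv_one_add_sq]
  exact integral_mono integrable_oddKernel.abs integrable_inv_one_add_sq abs_oddKernel_le

/-- The substitution `t ↦ a + ε t` moves `ε` from the kernel into the argument of `G`, leaving a
fixed integrable kernel for dominated convergence. -/
theorem integral_dilated_oddKernel_mul (G : ℝ → ℂ) (a : ℝ) {ε : ℝ} (hε : 0 < ε) :
    ∫ t, ((ε⁻¹ * oddKernel ((t - a) / ε) : ℝ) : ℂ) * G t =
      ∫ t, (oddKernel t : ℂ) * G (a + ε * t) := by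
  have h1 := integral_sub_right_eq_self (μ := (volume : Measure ℝ))
    (fun s => ((ε⁻¹ * oddKernel (s / ε) : ℝ) : ℂ) * G (a + s)) a
  have h2 := Measure.integral_comp_mul_left
    (fun s => ((ε⁻¹ * oddKernel (s / ε) : ℝ) : ℂ) * G (a + s)) ε
  simp only [add_sub_cancel] at h1
  rw [h1, ← inv_smul_smul₀ hε.ne' (∫ t, ((ε⁻¹ * oddKernel (t / ε) : ℝ) : ℂ) * G (a + t)),
    smul_comm]
  rw [abs_of_pos (inv_pos.2 hε)] at h2
  rw [← h2, ← integral_smul]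
  refine integral_congr_ae (ae_of_all _ fun t => ?_)
  simp only [Complex.real_smul]
  rw [mul_div_cancel_left₀ _ hε.ne', ← mul_assoc, ← Complex.ofReal_mul,
    mul_inv_cancel_left₀ hε.ne']

theorem norm_integral_dilated_oddKernel_mul_le {G : ℝ → ℂ} {M : ℝ} (hM : ∀ t, ‖G t‖ ≤ M) (a : ℝ)
    {ε : ℝ} (hε : 0 < ε) :
    ‖∫ t, ((ε⁻¹ * oddKernel ((t - a) / ε) : ℝ) : ℂ) * G t‖ ≤ Real.pi * M := by
  rw [integral_dilated_oddKernel_mul G a hε]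
  have h0 : 0 ≤ M := (norm_nonneg _).trans (hM 0)
  calc _ ≤ ∫ t, |oddKernel t| * M := by
        refine norm_integral_le_of_norm_le (integrable_oddKernel.abs.mul_const _)
          (ae_of_all _ fun t => ?_)
        rw [norm_mul, Complex.norm_real, Real.norm_eq_abs]
        gcongr
        exact hM _
    _ ≤ _ := by
        rw [integral_mul_const]
        exact mul_le_mul_of_nonneg_right integral_abs_oddKernel_le h0

/-- Dominated convergence gives `G a` times the integral of the kernel, which vanishes by oddness.
The domination needs `G` bounded; for the spectral density this comes from the resolvent estimate.
-/
theorem tendsto_integral_dilated_oddKernel_mul {G : ℝ → ℂ} (hGm : AEStronglyMeasurable G volume)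
    {M : ℝ} (hM : ∀ t, ‖G t‖ ≤ M) {a : ℝ} (hc : ContinuousAt G a) :
    Tendsto (fun ε : ℝ => ∫ t, ((ε⁻¹ * oddKernel ((t - a) / ε) : ℝ) : ℂ) * G t) (𝓝[>] 0)
      (𝓝 0) := by
  have h0 : (0 : ℂ) = ∫ t, (oddKernel t : ℂ) * G a := by
    rw [integral_eq_zero_of_odd]; intro t; rw [oddKernel_neg]; push_cast; ring
  rw [h0]
  have key : Tendsto (fun ε : ℝ => ∫ t, (oddKernel t : ℂ) * G (a + ε * t)) (𝓝[>] 0)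
      (𝓝 (∫ t, (oddKernel t : ℂ) * G a)) := by
    refine tendsto_integral_filter_of_dominated_convergence (fun t => |oddKernel t| * M) ?_ ?_
      (integrable_oddKernel.abs.mul_const _) ?_
    · filter_upwards [self_mem_nhdsWithin] with ε (hε : 0 < ε)
      refine (Complex.measurable_ofReal.comp measurable_oddKernel).aestronglyMeasurable.mul ?_
      -- `G` is only a.e. strongly measurable, so preimages of null sets under the affine map must
      -- be null.
      have hq : Measure.QuasiMeasurePreserving (fun t : ℝ => a + ε * t) volume volume := by
        refine ⟨by fun_prop, ?_⟩
        have : (fun t : ℝ => a + ε * t) = (fun t => a + t) ∘ (fun t => ε * t) := rfl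
        rw [this, ← Measure.map_map (by fun_prop) (by fun_prop), Real.map_volume_mul_left hε.ne',
          Measure.map_smul, map_add_left_eq_self]
        exact Measure.smul_absolutelyContinuous
      exact hGm.comp_quasiMeasurePreserving hq
    · filter_upwards with ε
      refine ae_of_all _ fun t => ?_
      rw [norm_mul, Complex.norm_real, Real.norm_eq_abs]
      gcongr
      exact hM _
    · refine ae_of_all _ fun t => Tendsto.const_mul _ ?_
      refine hc.tendsto.comp ?_
      have : Tendsto (fun ε : ℝ => a + ε * t) (𝓝 0) (𝓝 (a + 0 * t)) := by
        apply Continuous.tendsto; fun_prop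
      simpa using this.mono_left nhdsWithin_le_nhds
  refine key.congr' ?_
  filter_upwards [self_mem_nhdsWithin] with ε (hε : 0 < ε)
  rw [integral_dilated_oddKernel_mul G a hε]

/-- The truncated kernel of the Hilbert transform. -/
noncomputable def truncatedInv (δ t : ℝ) : ℝ := if δ < |t| then 1 / t else 0

/-- Compares the sharp cutoff at height `δ` with the smooth one given by the real part of the
resolvent kernel at distance `δ` from the axis. -/
theorem truncatedInv_eq {δ : ℝ} (hδ : 0 < δ) (t : ℝ) :
    truncatedInv δ t = t / (t ^ 2 + δ ^ 2) + δ⁻¹ * oddKernel (t / δ) := by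
  unfold truncatedInv oddKernel
  have h1 : (1 < |t / δ|) ↔ δ < |t| := by rw [abs_div, abs_of_pos hδ, one_lt_div hδ]
  have hp : 0 < t ^ 2 + δ ^ 2 := by positivity
  have hp' : 0 < 1 + (t / δ) ^ 2 := by positivity
  have h2 : δ⁻¹ * (t / δ / (1 + (t / δ) ^ 2)) = t / (t ^ 2 + δ ^ 2) := by
    field_simp; ring
  simp only [h1, mul_sub, h2]
  split_ifs with h
  · have ht : t ≠ 0 := by rintro rfl; simp at h; linarith
    field_simp; ring
  · ring

theorem abs_truncatedInv_le {δ : ℝ} (hδ : 0 < δ) (t : ℝ) : |truncatedInv δ t| ≤ δ⁻¹ := by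
  unfold truncatedInv
  split_ifs with h
  · rw [one_div, abs_inv]; exact inv_anti₀ hδ h.le
  · simpa using hδ.le

theorem measurable_truncatedInv (δ : ℝ) : Measurable (truncatedInv δ) :=
  Measurable.ite (measurableSet_lt measurable_const measurable_id.abs) (by fun_prop)
    measurable_const

theorem truncatedInv_neg (δ t : ℝ) : truncatedInv δ (-t) = -truncatedInv δ t := by
  unfold truncatedInv
  simp only [abs_neg]
  split_ifs <;> ring

/-- Subtracting the constant `G a` on a symmetric interval (the function `χ`) changes nothing,
because the truncated kernel is odd. The remainder divided by `t` is bounded near `0` by the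
Lipschitz condition and dominated by `r⁻¹ ‖G‖` elsewhere. -/
theorem exists_tendsto_integral_truncatedInv {G : ℝ → ℂ} (hG : Integrable G) {a : ℝ}
    (hO : (fun t => G t - G a) =O[𝓝 a] (fun t => t - a)) :
    ∃ l, Tendsto (fun δ : ℝ => ∫ t, (truncatedInv δ (t - a) : ℂ) * G t) (𝓝[>] 0) (𝓝 l) := by
  obtain ⟨c, hc⟩ := hO.bound
  obtain ⟨r, hr, hcr⟩ := Metric.eventually_nhds_iff.1 hc
  set χ : ℝ → ℂ := fun t => if |t| < r then G a else 0 with hχ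
  have hχi : Integrable χ := by
    have : χ = (Metric.ball (0 : ℝ) r).indicator (fun _ => G a) := by
      ext t; simp only [hχ, Set.indicator, mem_ball_zero_iff, Real.norm_eq_abs]
    rw [this, integrable_indicator_iff measurableSet_ball]
    exact integrableOn_const measure_ball_lt_top.ne
  have hGa : Integrable (fun t => G (a + t)) := hG.comp_add_left a
  have hdom : Integrable (fun t : ℝ => (if |t| < r then |c| else 0) + r⁻¹ * ‖G (a + t)‖) := by
    refine Integrable.add ?_ (hGa.norm.const_mul _)
    have : (fun t : ℝ => (if |t| < r then |c| else 0)) =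
        (Metric.ball (0 : ℝ) r).indicator (fun _ => |c|) := by
      ext t; simp only [Set.indicator, mem_ball_zero_iff, Real.norm_eq_abs]
    rw [this, integrable_indicator_iff measurableSet_ball]
    exact integrableOn_const measure_ball_lt_top.ne
  have hbd : ∀ (u t : ℝ), |u| ≤ |t|⁻¹ → ‖(u : ℂ) * (G (a + t) - χ t)‖ ≤
      (if |t| < r then |c| else 0) + r⁻¹ * ‖G (a + t)‖ := by
    intro u t hu
    rw [norm_mul, Complex.norm_real, Real.norm_eq_abs]
    simp only [hχ]
    split_ifs with h
    · have h1 := hcr (y := a + t) (by simpa [Real.dist_eq] using h)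
      simp only [add_sub_cancel_left, Real.norm_eq_abs] at h1
      have : |u| * ‖G (a + t) - G a‖ ≤ |c| := by
        rcases eq_or_ne t 0 with rfl | ht
        · simp
        calc _ ≤ |t|⁻¹ * (|c| * |t|) := by
              gcongr
              exact h1.trans (by gcongr; exact le_abs_self c)
          _ = |c| := by have := abs_pos.2 ht; field_simp
      have h3 : 0 ≤ r⁻¹ * ‖G (a + t)‖ := by positivity
      linarith
    · rw [sub_zero, zero_add]
      gcongr
      exact hu.trans (inv_anti₀ hr (not_lt.1 h))
  have habs : ∀ δ t : ℝ, |truncatedInv δ t| ≤ |t|⁻¹ := by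
    intro δ t
    unfold truncatedInv
    split_ifs
    · rw [one_div, abs_inv]
    · simp
  refine ⟨∫ t, ((t⁻¹ : ℝ) : ℂ) * (G (a + t) - χ t), ?_⟩
  have key : Tendsto (fun δ : ℝ => ∫ t, (truncatedInv δ t : ℂ) * (G (a + t) - χ t)) (𝓝[>] 0)
      (𝓝 (∫ t, ((t⁻¹ : ℝ) : ℂ) * (G (a + t) - χ t))) := by
    refine tendsto_integral_filter_of_dominated_convergence _ ?_ ?_ hdom ?_
    · filter_upwards with δ
      exact (Complex.measurable_ofReal.comp
        (measurable_truncatedInv δ)).aestronglyMeasurable.mul (hGa.sub hχi).1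
    · filter_upwards with δ
      exact ae_of_all _ fun t => hbd _ _ (habs δ t)
    · have : ∀ᵐ t : ℝ, t ≠ 0 := by simp [ae_iff, measure_singleton]
      filter_upwards [this] with t ht
      refine tendsto_const_nhds.congr' ?_
      have : ∀ᶠ δ : ℝ in 𝓝[>] 0, δ < |t| :=
        nhdsWithin_le_nhds (eventually_lt_nhds (abs_pos.2 ht))
      filter_upwards [this] with δ hδ
      simp [truncatedInv, hδ]
  refine key.congr' ?_
  filter_upwards [self_mem_nhdsWithin] with δ (hδ : 0 < δ)
  have hb : ∀ H : ℝ → ℂ, Integrable H → Integrable fun t => (truncatedInv δ t : ℂ) * H t := by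
    intro H hH
    refine hH.bdd_mul (c := δ⁻¹) (Complex.measurable_ofReal.comp
      (measurable_truncatedInv δ)).aestronglyMeasurable (ae_of_all _ fun t => ?_)
    simpa using abs_truncatedInv_le hδ t
  have h0 : ∫ t, (truncatedInv δ t : ℂ) * χ t = 0 := by
    apply integral_eq_zero_of_odd
    intro t
    simp only [truncatedInv_neg, hχ, abs_neg, Complex.ofReal_neg, neg_mul]
  simp only [mul_sub]
  rw [integral_sub (hb _ hGa) (hb _ hχi), h0, sub_zero,
    ← integral_sub_right_eq_self (μ := (volume : Measure ℝ))
      (fun t => (truncatedInv δ t : ℂ) * G (a + t)) a]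
  simp

section FourierSide

/-! ### Test functions and their Fourier transforms -/

/-- The Euclidean space `ℝⁿ`. -/
abbrev Euc (n : ℕ) : Type := EuclideanSpace ℝ (Fin n)

/-- Square integrable functions that are integrable together with their first moments. -/
structure IsTestFunction {n : ℕ} (f : Euc n → ℂ) : Prop where
  memLp : MemLp f 2 volume
  integrable : Integrable f volume
  integrable_norm_mul : Integrable (fun y => ‖y‖ * ‖f y‖) volume

theorem IsTestFunction.conj {n : ℕ} {f : Euc n → ℂ} (hf : IsTestFunction f) :
    IsTestFunction (fun y => conj (f y)) where
  memLp := hf.memLp.star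
  integrable := by
    refine hf.integrable.congr' ?_ (ae_of_all _ fun y => by simp)
    exact Complex.continuous_conj.comp_aestronglyMeasurable hf.integrable.1
  integrable_norm_mul := by simpa using hf.integrable_norm_mul

/-- The integral `∫ e^{i y·ξ} f(y) dy`. -/
noncomputable def oscIntegral {n : ℕ} (f : Euc n → ℂ) (ξ : Euc n) : ℂ :=
  ∫ y, Complex.exp (Complex.I * (inner ℝ y ξ : ℝ)) * f y

theorem norm_exp_I_mul_sub_le (a b : ℝ) :
    ‖Complex.exp (Complex.I * a) - Complex.exp (Complex.I * b)‖ ≤ |a - b| := by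
  have : Complex.exp (Complex.I * a) - Complex.exp (Complex.I * b) =
      Complex.exp (Complex.I * b) * (Complex.exp (Complex.I * (a - b : ℝ)) - 1) := by
    rw [mul_sub, ← Complex.exp_add, mul_one]
    congr 2
    push_cast; ring
  rw [this, norm_mul, Complex.norm_exp_I_mul_ofReal, one_mul]
  exact Real.norm_exp_I_mul_ofReal_sub_one_le

variable {n : ℕ}

theorem integrable_exp_inner_mul {f : Euc n → ℂ} (hf : Integrable f volume) (ξ : Euc n) :
    Integrable (fun y => Complex.exp (Complex.I * (inner ℝ y ξ : ℝ)) * f y) volume := by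
  refine hf.bdd_mul (c := 1) (Continuous.aestronglyMeasurable (by fun_prop))
    (ae_of_all _ fun y => ?_)
  rw [Complex.norm_exp_I_mul_ofReal]

theorem norm_oscIntegral_le {f : Euc n → ℂ} (ξ : Euc n) :
    ‖oscIntegral f ξ‖ ≤ ∫ y, ‖f y‖ := by
  refine (norm_integral_le_integral_norm _).trans_eq ?_
  simp only [norm_mul, Complex.norm_exp_I_mul_ofReal, one_mul]

/-- The first moment serves as Lipschitz constant. This is the source of the regularity of the
spectral density that the principal value requires. -/
theorem norm_oscIntegral_sub_le {f : Euc n → ℂ} (hf : IsTestFunction f) (ξ η : Euc n) :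
    ‖oscIntegral f ξ - oscIntegral f η‖ ≤ (∫ y, ‖y‖ * ‖f y‖) * ‖ξ - η‖ := by
  unfold oscIntegral
  rw [← integral_sub (integrable_exp_inner_mul hf.integrable _)
    (integrable_exp_inner_mul hf.integrable _), ← integral_mul_const]
  refine norm_integral_le_of_norm_le (hf.integrable_norm_mul.mul_const _) (ae_of_all _ fun y => ?_)
  rw [← sub_mul, norm_mul, mul_right_comm]
  refine mul_le_mul_of_nonneg_right ((norm_exp_I_mul_sub_le _ _).trans ?_) (norm_nonneg _)
  rw [← inner_sub_right]
  exact abs_real_inner_le_norm _ _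

theorem continuous_oscIntegral {f : Euc n → ℂ} (hf : IsTestFunction f) :
    Continuous (oscIntegral f) := by
  refine (LipschitzWith.of_dist_le_mul (K := (∫ y, ‖y‖ * ‖f y‖).toNNReal)
    fun ξ η => ?_).continuous
  rw [dist_eq_norm, dist_eq_norm]
  refine (norm_oscIntegral_sub_le hf ξ η).trans ?_
  gcongr
  exact Real.le_coe_toNNReal _

/-- `oscIntegral` carries the sign `+i` so that `e^{-i(x-y)·ξ}` factors without reflecting the
sphere; the price is the dilation by `-2π` here. -/
theorem fourier_eq_oscIntegral (f : Euc n → ℂ) (η : Euc n) :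
    𝓕 f η = oscIntegral f (-((2 * Real.pi) • η)) := by
  rw [Real.fourier_eq', oscIntegral]
  refine integral_congr_ae (ae_of_all _ fun y => ?_)
  simp only [smul_eq_mul, inner_neg_right, inner_smul_right]
  congr 2
  push_cast; ring

/-- On integrable functions, the Fourier transform of `L²` is given by the integral. -/
theorem coeFn_fourier_toLp {f : Euc n → ℂ} (hf : IsTestFunction f) :
    (𝓕 (hf.memLp.toLp f : L2 n) : L2 n) =ᵐ[volume] 𝓕 f := by
  set u : L2 n := hf.memLp.toLp f with hu
  have hcont : Continuous (𝓕 f) := by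
    have : 𝓕 f = fun η => oscIntegral f (-((2 * Real.pi) • η)) :=
      funext (fourier_eq_oscIntegral f)
    rw [this]
    exact (continuous_oscIntegral hf).comp (by fun_prop)
  have hloc : LocallyIntegrable (𝓕 u : L2 n) volume :=
    (Lp.memLp (𝓕 u : L2 n)).locallyIntegrable (by norm_num)
  refine ae_eq_of_integral_contDiff_smul_eq hloc hcont.locallyIntegrable fun g hg hgc => ?_
  have hgc' : HasCompactSupport (fun x => (g x : ℂ)) := hgc.comp_left (g := Complex.ofReal) rfl
  have hg' : ContDiff ℝ ∞ (fun x => (g x : ℂ)) := Complex.ofRealCLM.contDiff.comp hg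
  set φ : 𝓢(Euc n, ℂ) := hgc'.toSchwartzMap hg' with hφ
  -- Both transforms are tested against `φ`: the one on `L²` agrees with the distributional one, and
  -- the integral one is moved onto `φ` by Fubini.
  have h1 := congrArg (fun T => T φ) (Lp.fourier_toTemperedDistribution_eq u)
  simp only [TemperedDistribution.fourier_apply, Lp.toTemperedDistribution_apply] at h1
  have h2 : ∫ x, (𝓕 φ) x • u x = ∫ x, f x • (𝓕 (φ : Euc n → ℂ)) x := by
    refine integral_congr_ae ?_
    filter_upwards [hf.memLp.coeFn_toLp] with x hx
    rw [← hu] at hx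
    rw [hx, smul_eq_mul, smul_eq_mul, mul_comm, SchwartzMap.fourier_coe]
  have h3 : ∫ ξ, 𝓕 f ξ • φ ξ = ∫ x, f x • (𝓕 (φ : Euc n → ℂ)) x := by
    have := VectorFourier.integral_fourierIntegral_smul_eq_flip (L := innerₗ (Euc n))
      Real.continuous_fourierChar continuous_inner hf.integrable (φ.integrable (μ := volume))
    rw [flip_innerₗ] at this
    exact this
  rw [h2, ← h3] at h1
  have h4 : ∀ x, φ x = (g x : ℂ) := fun x => rfl
  simp only [h4] at h1
  simpa [mul_comm] using h1.symm

/-! ### Fourier multipliers -/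

theorem memLp_mul_fourier {m : Euc n → ℂ} (hm : Measurable m) {M : ℝ} (hM : ∀ ξ, ‖m ξ‖ ≤ M)
    (f : L2 n) :
    MemLp (fun ξ => m ((2 * Real.pi) • ξ) * (𝓕 f : L2 n) ξ) 2 volume := by
  refine (Lp.memLp (𝓕 f : L2 n)).of_le_mul (c := M) ?_ (ae_of_all _ fun ξ => ?_)
  · exact (hm.comp (by fun_prop)).aestronglyMeasurable.mul (Lp.aestronglyMeasurable _)
  · rw [norm_mul]
    exact mul_le_mul_of_nonneg_right (hM _) (norm_nonneg _)

theorem fourierMultiplierL2_eq {m : Euc n → ℂ} (hm : Measurable m) {M : ℝ}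
    (hM : ∀ ξ, ‖m ξ‖ ≤ M) (f : L2 n) :
    fourierMultiplierL2 m f = 𝓕⁻ ((memLp_mul_fourier hm hM f).toLp _ : L2 n) :=
  dif_pos _

/-- A bounded measurable symbol gives a bounded operator on `L²`. -/
theorem exists_clm_eq_fourierMultiplierL2 {m : Euc n → ℂ} (hm : Measurable m) {M : ℝ}
    (hM : ∀ ξ, ‖m ξ‖ ≤ M) :
    ∃ A : L2 n →L[ℂ] L2 n, ∀ f, A f = fourierMultiplierL2 m f := by
  refine ⟨LinearMap.mkContinuous
    { toFun := fourierMultiplierL2 m, map_add' := fun f g => ?_, map_smul' := fun c f => ?_ } M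
    fun f => ?_, fun f => rfl⟩
  · simp only [fourierMultiplierL2_eq hm hM]
    rw [← FourierTransform.fourierInv_add, ← MemLp.toLp_add]
    congr 1
    refine MemLp.toLp_congr _ _ ?_
    rw [FourierTransform.fourier_add]
    filter_upwards [Lp.coeFn_add (𝓕 f : L2 n) (𝓕 g : L2 n)] with ξ h
    simp only [h, Pi.add_apply, mul_add]
  · simp only [fourierMultiplierL2_eq hm hM, RingHom.id_apply]
    rw [← FourierTransform.fourierInv_smul, ← MemLp.toLp_const_smul]
    congr 1
    refine MemLp.toLp_congr _ _ ?_
    rw [FourierTransform.fourier_smul]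
    filter_upwards [Lp.coeFn_smul c (𝓕 f : L2 n)] with ξ h
    simp only [h, Pi.smul_apply, smul_eq_mul, mul_left_comm]
  · change ‖fourierMultiplierL2 m f‖ ≤ _
    rw [fourierMultiplierL2_eq hm hM, ← Lp.norm_fourier_eq,
      FourierTransform.fourier_fourierInv_eq, ← Lp.norm_fourier_eq f]
    refine Lp.norm_le_mul_norm_of_ae_le_mul ?_
    filter_upwards [(memLp_mul_fourier hm hM f).coeFn_toLp] with ξ h
    rw [h, norm_mul]
    exact mul_le_mul_of_nonneg_right (hM _) (norm_nonneg _)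

theorem integral_mul_conj_eq_inner (u v : L2 n) : ∫ x, u x * conj (v x) = inner ℂ v u := by
  rw [L2.inner_def]
  rfl

/-- Parseval followed by the dilation `ξ ↦ -2π ξ`, whose Jacobian is the factor `(2π)⁻ⁿ`. The sign
is harmless because the symbol is radial. -/
theorem pairing_fourierMultiplierL2 {m : ℝ → ℂ} (hm : Measurable m) {M : ℝ}
    (hM : ∀ t, ‖m t‖ ≤ M) {f g : Euc n → ℂ} (hf : IsTestFunction f) (hg : IsTestFunction g) :
    pairing (fourierMultiplierL2 (fun ξ => m (‖ξ‖ ^ 2)) (hf.memLp.toLp f)) g =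
      ((2 * Real.pi : ℂ) ^ n)⁻¹ *
        ∫ ξ, m (‖ξ‖ ^ 2) * (oscIntegral f ξ * conj (oscIntegral g ξ)) := by
  have hm' : Measurable fun ξ : Euc n => m (‖ξ‖ ^ 2) := hm.comp (by fun_prop)
  have hM' : ∀ ξ : Euc n, ‖m (‖ξ‖ ^ 2)‖ ≤ M := fun ξ => hM _
  have h1 : pairing (fourierMultiplierL2 (fun ξ => m (‖ξ‖ ^ 2)) (hf.memLp.toLp f)) g =
      inner ℂ (hg.memLp.toLp g : L2 n)
        (fourierMultiplierL2 (fun ξ => m (‖ξ‖ ^ 2)) (hf.memLp.toLp f)) := by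
    rw [← integral_mul_conj_eq_inner, pairing]
    refine integral_congr_ae ?_
    filter_upwards [hg.memLp.coeFn_toLp] with x hx
    rw [hx]
  rw [h1, ← Lp.inner_fourier_eq, fourierMultiplierL2_eq hm' hM',
    FourierTransform.fourier_fourierInv_eq, ← integral_mul_conj_eq_inner]
  have h2 := Measure.integral_comp_smul (volume : Measure (Euc n))
    (fun ξ => m (‖ξ‖ ^ 2) * (oscIntegral f ξ * conj (oscIntegral g ξ))) (-(2 * Real.pi))
  have h3 : ((|((-(2 * Real.pi)) ^ Module.finrank ℝ (Euc n))⁻¹| : ℝ) : ℂ) =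
      ((2 * Real.pi : ℂ) ^ n)⁻¹ := by
    rw [finrank_euclideanSpace_fin, abs_inv, abs_pow, abs_neg, abs_of_pos Real.two_pi_pos]
    push_cast; rfl
  rw [← h3, ← Complex.real_smul, ← h2]
  refine integral_congr_ae ?_
  filter_upwards [(memLp_mul_fourier hm' hM' (hf.memLp.toLp f)).coeFn_toLp,
    coeFn_fourier_toLp hf, coeFn_fourier_toLp hg] with ξ h4 h5 h6
  rw [h4, h5, h6, fourier_eq_oscIntegral, fourier_eq_oscIntegral, neg_smul, norm_neg, mul_assoc]

theorem integrable_oscIntegral_mul_conj {f g : Euc n → ℂ} (hf : IsTestFunction f)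
    (hg : IsTestFunction g) :
    Integrable (fun ξ => oscIntegral f ξ * conj (oscIntegral g ξ)) volume := by
  have h := L2.integrable_inner (𝕜 := ℂ) (𝓕 (hg.memLp.toLp g : L2 n) : L2 n)
    (𝓕 (hf.memLp.toLp f : L2 n) : L2 n)
  have h2 : Integrable (fun ξ => oscIntegral f ((-(2 * Real.pi)) • ξ) *
      conj (oscIntegral g ((-(2 * Real.pi)) • ξ))) volume := by
    refine h.congr ?_
    filter_upwards [coeFn_fourier_toLp hf, coeFn_fourier_toLp hg] with ξ h5 h6
    rw [h5, h6, fourier_eq_oscIntegral, fourier_eq_oscIntegral, neg_smul]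
    rfl
  have h0 : (-(2 * Real.pi)) ≠ 0 := neg_ne_zero.2 Real.two_pi_pos.ne'
  exact (integrable_comp_smul_iff volume
    (fun ξ => oscIntegral f ξ * conj (oscIntegral g ξ)) h0).1 h2

/-! ### Integration over spheres -/

instance isFiniteMeasure_sphereMeasure (r : ℝ) : IsFiniteMeasure (sphereMeasure n r) := by
  unfold sphereMeasure
  exact Measure.smul_finite _ ENNReal.ofReal_ne_top

theorem integral_sphereMeasure {H : Euc n → ℂ} (hH : Continuous H) {r : ℝ} (hr : 0 ≤ r) :
    ∫ ξ, H ξ ∂(sphereMeasure n r) = (r ^ (n - 1) : ℝ) •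
      ∫ v : Metric.sphere (0 : Euc n) 1, H (r • (v : Euc n))
        ∂(volume : Measure (Euc n)).toSphere := by
  unfold sphereMeasure
  rw [integral_smul_measure, integral_map (Continuous.aemeasurable (by fun_prop))
    hH.aestronglyMeasurable, ENNReal.toReal_ofReal (by positivity)]

theorem integrable_polar (hn : 2 ≤ n) {H : Euc n → ℂ} (hH : Integrable H volume) :
    Integrable (fun p : Metric.sphere (0 : Euc n) 1 × Set.Ioi (0 : ℝ) => H (p.2.1 • p.1.1))
      ((volume : Measure (Euc n)).toSphere.prod (Measure.volumeIoiPow (n - 1))) := by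
  have : Nontrivial (Euc n) :=
    Module.nontrivial_of_finrank_pos (R := ℝ) (by rw [finrank_euclideanSpace_fin]; lia)
  have hmp := (volume : Measure (Euc n)).measurePreserving_homeomorphUnitSphereProd
  rw [finrank_euclideanSpace_fin] at hmp
  rw [← hmp.integrable_comp_emb (Homeomorph.measurableEmbedding _)]
  have h1 : ((fun p : Metric.sphere (0 : Euc n) 1 × Set.Ioi (0 : ℝ) => H (p.2.1 • p.1.1)) ∘
      homeomorphUnitSphereProd (Euc n)) = H ∘ (Subtype.val : ({0}ᶜ : Set (Euc n)) → Euc n) := by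
    ext x
    have := homeomorphUnitSphereProd_symm_apply_coe (Euc n) (homeomorphUnitSphereProd (Euc n) x)
    rw [Homeomorph.symm_apply_apply] at this
    simp only [Function.comp_apply]
    rw [this]
  rw [h1, ← integrableOn_iff_comap_subtypeVal (measurableSet_singleton _).compl]
  exact hH.integrableOn

theorem integral_polar (hn : 2 ≤ n) (H : Euc n → ℂ) :
    ∫ ξ, H ξ = ∫ p : Metric.sphere (0 : Euc n) 1 × Set.Ioi (0 : ℝ), H (p.2.1 • p.1.1)
      ∂((volume : Measure (Euc n)).toSphere.prod (Measure.volumeIoiPow (n - 1))) := by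
  have : Nontrivial (Euc n) :=
    Module.nontrivial_of_finrank_pos (R := ℝ) (by rw [finrank_euclideanSpace_fin]; lia)
  have hmp := (volume : Measure (Euc n)).measurePreserving_homeomorphUnitSphereProd
  rw [finrank_euclideanSpace_fin] at hmp
  rw [← hmp.integral_comp (Homeomorph.measurableEmbedding _)]
  have h1 : ∀ x : ({0}ᶜ : Set (Euc n)), H ((homeomorphUnitSphereProd (Euc n) x).2.1 •
      (homeomorphUnitSphereProd (Euc n) x).1.1) = H x := by
    intro x
    have := homeomorphUnitSphereProd_symm_apply_coe (Euc n) (homeomorphUnitSphereProd (Euc n) x)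
    rw [Homeomorph.symm_apply_apply] at this
    rw [← this]
  simp only [h1]
  -- The polar map omits the origin, which is a null set in a nontrivial space.
  rw [integral_subtype_comap (measurableSet_singleton _).compl H, restrict_compl_singleton]

theorem integral_volumeIoiPow (k : ℕ) (φ : ℝ → ℂ) :
    ∫ r : Set.Ioi (0 : ℝ), φ r ∂(Measure.volumeIoiPow k) =
      ∫ r in Set.Ioi (0 : ℝ), (r ^ k : ℝ) • φ r := by
  simp only [Measure.volumeIoiPow, ENNReal.ofReal]
  rw [integral_withDensity_eq_integral_smul,
    integral_subtype_comap measurableSet_Ioi fun a ↦ Real.toNNReal (a ^ k) • φ a,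
    setIntegral_congr_fun measurableSet_Ioi fun x hx ↦ ?_]
  · rw [NNReal.smul_def, Real.coe_toNNReal _ (pow_nonneg hx.out.le _)]
  · exact (measurable_subtype_coe.pow_const _).real_toNNReal

theorem integrableOn_of_volumeIoiPow {k : ℕ} {φ : ℝ → ℂ}
    (h : Integrable (fun r : Set.Ioi (0 : ℝ) => φ r) (Measure.volumeIoiPow k)) :
    IntegrableOn (fun r => (r ^ k : ℝ) • φ r) (Set.Ioi 0) volume := by
  rw [Measure.volumeIoiPow, integrable_withDensity_iff_integrable_smul' (by fun_prop)
    (by simp)] at h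
  rw [integrableOn_iff_comap_subtypeVal measurableSet_Ioi]
  refine h.congr (ae_of_all _ fun r => ?_)
  have : 0 ≤ (r : ℝ) ^ k := pow_nonneg (le_of_lt r.2) _
  simp [ENNReal.toReal_ofReal this]

/-- Integration in polar coordinates, in terms of the surface measures. -/
theorem integral_radial_mul (hn : 2 ≤ n) {m : ℝ → ℂ} (hm : Measurable m) {M : ℝ}
    (hM : ∀ t, ‖m t‖ ≤ M) {H : Euc n → ℂ} (hc : Continuous H) (hH : Integrable H volume) :
    ∫ ξ, m (‖ξ‖ ^ 2) * H ξ =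
      ∫ r in Set.Ioi (0 : ℝ), m (r ^ 2) * ∫ ξ, H ξ ∂(sphereMeasure n r) := by
  have hmH : Integrable (fun ξ : Euc n => m (‖ξ‖ ^ 2) * H ξ) volume :=
    hH.bdd_mul (c := M) (hm.comp (by fun_prop)).aestronglyMeasurable (ae_of_all _ fun ξ => hM _)
  rw [integral_polar hn, integral_prod_symm _ (integrable_polar hn hmH)]
  have h1 : ∀ r : Set.Ioi (0 : ℝ), ∫ v : Metric.sphere (0 : Euc n) 1,
      m (‖r.1 • v.1‖ ^ 2) * H (r.1 • v.1) ∂(volume : Measure (Euc n)).toSphere =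
      (fun r : ℝ => m (r ^ 2) * ∫ v : Metric.sphere (0 : Euc n) 1, H (r • v.1)
        ∂(volume : Measure (Euc n)).toSphere) r := by
    intro r
    simp only
    rw [← integral_const_mul]
    refine integral_congr_ae (ae_of_all _ fun v => ?_)
    have hv : ‖v.1‖ = 1 := by simp
    simp only [norm_smul, hv, mul_one, Real.norm_eq_abs, sq_abs]
  rw [integral_congr_ae (ae_of_all _ h1)]
  rw [integral_volumeIoiPow (n - 1) (fun r : ℝ => m (r ^ 2) * ∫ v : Metric.sphere (0 : Euc n) 1,
    H (r • v.1) ∂(volume : Measure (Euc n)).toSphere)]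
  refine setIntegral_congr_fun measurableSet_Ioi fun r (hr : 0 < r) => ?_
  rw [integral_sphereMeasure hc hr.le, mul_smul_comm]

theorem integrableOn_integral_sphereMeasure (hn : 2 ≤ n) {H : Euc n → ℂ} (hc : Continuous H)
    (hH : Integrable H volume) :
    IntegrableOn (fun r => ∫ ξ, H ξ ∂(sphereMeasure n r)) (Set.Ioi 0) volume := by
  have h := (integrable_polar hn hH).integral_prod_right
  have h2 := integrableOn_of_volumeIoiPow (φ := fun r : ℝ => ∫ v : Metric.sphere (0 : Euc n) 1,
    H (r • v.1) ∂(volume : Measure (Euc n)).toSphere) h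
  refine h2.congr_fun (fun r (hr : 0 < r) => ?_) measurableSet_Ioi
  simp only
  rw [integral_sphereMeasure hc hr.le]

/-! ### The spectral density of the Laplacian -/

/-- The density of the spectral measure `⟨dE(t) f, g⟩` of `-Δ`. -/
noncomputable def spectralDensity (f g : Euc n → ℂ) (t : ℝ) : ℂ :=
  if 0 < t then ((2 * Real.pi : ℂ) ^ n)⁻¹ * ((1 / (2 * √t) : ℝ) : ℂ) *
    ∫ ξ, oscIntegral f ξ * conj (oscIntegral g ξ) ∂(sphereMeasure n (√t)) else 0

/-- Puts the Jacobian of `r = t^{1/2}`, as the power substitution produces it, in the form used by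
`spectralDensity`. -/
theorem sqrt_smul_eq (φ : ℝ → ℂ) {t : ℝ} (ht : 0 < t) :
    ((1 / 2 : ℝ) * t ^ ((1 / 2 : ℝ) - 1)) • φ (t ^ (1 / 2 : ℝ)) =
      ((1 / (2 * √t) : ℝ) : ℂ) * φ (√t) := by
  rw [← Real.sqrt_eq_rpow, Complex.real_smul, Real.rpow_sub_one ht.ne', ← Real.sqrt_eq_rpow]
  congr 2
  have h := Real.sq_sqrt ht.le
  have h2 := Real.sqrt_pos.2 ht
  rw [eq_div_iff (by positivity)]
  field_simp
  linarith

theorem integral_comp_sqrt (φ : ℝ → ℂ) :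
    ∫ t in Set.Ioi (0 : ℝ), ((1 / (2 * √t) : ℝ) : ℂ) * φ (√t) = ∫ r in Set.Ioi (0 : ℝ), φ r := by
  rw [← integral_comp_rpow_Ioi_of_pos (g := φ) (p := 1 / 2) (by norm_num)]
  exact setIntegral_congr_fun measurableSet_Ioi fun t ht => (sqrt_smul_eq φ ht).symm

theorem integrableOn_comp_sqrt {φ : ℝ → ℂ} (h : IntegrableOn φ (Set.Ioi 0) volume) :
    IntegrableOn (fun t : ℝ => ((1 / (2 * √t) : ℝ) : ℂ) * φ (√t)) (Set.Ioi 0) volume := by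
  have := (integrableOn_Ioi_comp_rpow_iff φ (p := 1 / 2) (by norm_num)).2 h
  refine this.congr_fun (fun t ht => ?_) measurableSet_Ioi
  rw [abs_of_pos (by norm_num)]
  exact sqrt_smul_eq φ ht

variable {f g : Euc n → ℂ}

theorem continuous_oscIntegral_mul_conj (hf : IsTestFunction f) (hg : IsTestFunction g) :
    Continuous fun ξ => oscIntegral f ξ * conj (oscIntegral g ξ) :=
  (continuous_oscIntegral hf).mul (Complex.continuous_conj.comp (continuous_oscIntegral hg))

theorem spectralDensity_eq_indicator (f g : Euc n → ℂ) :
    spectralDensity f g = (Set.Ioi (0 : ℝ)).indicator fun t =>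
      ((2 * Real.pi : ℂ) ^ n)⁻¹ * (((1 / (2 * √t) : ℝ) : ℂ) *
        ∫ ξ, oscIntegral f ξ * conj (oscIntegral g ξ) ∂(sphereMeasure n (√t))) := by
  ext t
  simp only [spectralDensity, Set.indicator, Set.mem_Ioi, mul_assoc]

theorem integrable_spectralDensity (hn : 2 ≤ n) (hf : IsTestFunction f) (hg : IsTestFunction g) :
    Integrable (spectralDensity f g) volume := by
  rw [spectralDensity_eq_indicator, integrable_indicator_iff measurableSet_Ioi]
  exact (integrableOn_comp_sqrt (integrableOn_integral_sphereMeasure hn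
    (continuous_oscIntegral_mul_conj hf hg)
    (integrable_oscIntegral_mul_conj hf hg))).const_mul _

/-- The functional calculus of `-Δ` in terms of its spectral density. -/
theorem pairing_fourierMultiplierL2_eq_integral (hn : 2 ≤ n) {m : ℝ → ℂ} (hm : Measurable m)
    {M : ℝ} (hM : ∀ t, ‖m t‖ ≤ M) (hf : IsTestFunction f) (hg : IsTestFunction g) :
    pairing (fourierMultiplierL2 (fun ξ => m (‖ξ‖ ^ 2)) (hf.memLp.toLp f)) g =
      ∫ t, m t * spectralDensity f g t := by
  rw [pairing_fourierMultiplierL2 hm hM hf hg, integral_radial_mul hn hm hM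
    (continuous_oscIntegral_mul_conj hf hg) (integrable_oscIntegral_mul_conj hf hg),
    ← integral_comp_sqrt, ← integral_const_mul, ← integral_indicator measurableSet_Ioi]
  refine integral_congr_ae (ae_of_all _ fun t => ?_)
  simp only [spectralDensity, Set.indicator, Set.mem_Ioi]
  split_ifs with ht
  · simp only [Real.sq_sqrt ht.le]
    ring
  · simp

/-- Near `a > 0` the density is `A(√t) Φ(√t)`, where `A` is an explicit factor differentiable away
from `0` and `Φ` averages over the unit sphere a product of bounded Lipschitz functions. Since `√`
is differentiable at `a`, the estimate passes from `√t` to `t`. -/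
theorem isBigO_spectralDensity (hf : IsTestFunction f) (hg : IsTestFunction g) {a : ℝ}
    (ha : 0 < a) :
    (fun t => spectralDensity f g t - spectralDensity f g a) =O[𝓝 a] (fun t => t - a) := by
  set ν := (volume : Measure (Euc n)).toSphere with hν
  set H : Euc n → ℂ := fun ξ => oscIntegral f ξ * conj (oscIntegral g ξ) with hH
  set Φ : ℝ → ℂ := fun r => ∫ v : Metric.sphere (0 : Euc n) 1, H (r • v.1) ∂ν with hΦ
  set A : ℝ → ℂ := fun r => ((2 * Real.pi : ℂ) ^ n)⁻¹ * ((1 / (2 * r) : ℝ) : ℂ) *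
    ((r ^ (n - 1) : ℝ) : ℂ) with hA
  have hHc : Continuous H := continuous_oscIntegral_mul_conj hf hg
  have heq : ∀ t, 0 < t → spectralDensity f g t = A (√t) * Φ (√t) := by
    intro t ht
    rw [spectralDensity, if_pos ht, integral_sphereMeasure hHc (Real.sqrt_nonneg _),
      Complex.real_smul]
    simp only [hA, hΦ, mul_assoc]
    rfl
  set b := √a with hb
  have hb0 : 0 < b := Real.sqrt_pos.2 ha
  have hAd : DifferentiableAt ℝ A b := by
    have h1 : DifferentiableAt ℝ (fun r : ℝ => 1 / (2 * r)) b :=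
      (differentiableAt_const _).div (by fun_prop) (by positivity)
    have h2 : DifferentiableAt ℝ (fun r : ℝ => ((1 / (2 * r) : ℝ) : ℂ)) b :=
      Complex.ofRealCLM.differentiableAt.comp b h1
    have h3 : DifferentiableAt ℝ (fun r : ℝ => ((r ^ (n - 1) : ℝ) : ℂ)) b :=
      Complex.ofRealCLM.differentiableAt.comp b (differentiableAt_pow (n - 1))
    exact (h2.const_mul _).mul h3
  -- Product rule: a first moment bounds the increment of one factor, and an `L¹` norm bounds the
  -- other factor.
  obtain ⟨K, hK⟩ : ∃ K : ℝ, ∀ ξ η, ‖H ξ - H η‖ ≤ K * ‖ξ - η‖ := by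
    refine ⟨(∫ y, ‖y‖ * ‖f y‖) * (∫ y, ‖g y‖) + (∫ y, ‖f y‖) * (∫ y, ‖y‖ * ‖g y‖),
      fun ξ η => ?_⟩
    have h1 : H ξ - H η = (oscIntegral f ξ - oscIntegral f η) * conj (oscIntegral g ξ) +
        oscIntegral f η * conj (oscIntegral g ξ - oscIntegral g η) := by
      simp only [hH, map_sub]; ring
    rw [h1, add_mul]
    refine (norm_add_le _ _).trans (add_le_add ?_ ?_)
    · rw [norm_mul, RCLike.norm_conj, mul_right_comm]
      exact mul_le_mul (norm_oscIntegral_sub_le hf _ _) (norm_oscIntegral_le _) (norm_nonneg _)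
        (by positivity)
    · rw [norm_mul, RCLike.norm_conj, mul_assoc]
      exact mul_le_mul (norm_oscIntegral_le _) (norm_oscIntegral_sub_le hg _ _) (norm_nonneg _)
        (by positivity)
  have hHi : ∀ r : ℝ, Integrable (fun v : Metric.sphere (0 : Euc n) 1 => H (r • v.1)) ν := by
    intro r
    refine Integrable.of_bound (C := (∫ y, ‖f y‖) * (∫ y, ‖g y‖))
      (hHc.comp (by fun_prop)).aestronglyMeasurable (ae_of_all _ fun v => ?_)
    rw [norm_mul, RCLike.norm_conj]
    exact mul_le_mul (norm_oscIntegral_le _) (norm_oscIntegral_le _) (norm_nonneg _)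
      (by positivity)
  have hΦO : (fun r => Φ r - Φ b) =O[𝓝 b] (fun r => r - b) := by
    refine Asymptotics.IsBigO.of_bound (K * ν.real Set.univ) (Eventually.of_forall fun r => ?_)
    simp only [hΦ]
    rw [← integral_sub (hHi r) (hHi b)]
    refine (norm_integral_le_of_norm_le_const (C := K * ‖r - b‖)
      (ae_of_all _ fun v => ?_)).trans_eq (by ring)
    refine (hK _ _).trans_eq ?_
    have hv : ‖v.1‖ = 1 := by simp
    rw [← sub_smul, norm_smul, hv, mul_one]
  have hAO := hAd.isBigO_sub
  have hprod : (fun r => A r * Φ r - A b * Φ b) =O[𝓝 b] (fun r => r - b) := by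
    have h1 : (fun r => A r * (Φ r - Φ b)) =O[𝓝 b] (fun r => (1 : ℝ) * (r - b)) :=
      (hAd.continuousAt.isBigO_one ℝ).mul hΦO
    have h2 : (fun r => (A r - A b) * Φ b) =O[𝓝 b] (fun r => (r - b) * (1 : ℝ)) :=
      hAO.mul (Asymptotics.isBigO_const_const _ one_ne_zero _)
    simp only [one_mul, mul_one] at h1 h2
    refine (h1.add h2).congr_left fun r => ?_
    ring
  have hsq : Tendsto (fun t : ℝ => √t) (𝓝 a) (𝓝 b) := Real.continuous_sqrt.tendsto a
  have h3 := (hprod.comp_tendsto hsq).trans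
    ((Real.hasDerivAt_sqrt ha.ne').differentiableAt.isBigO_sub)
  refine h3.congr' ?_ EventuallyEq.rfl
  filter_upwards [eventually_gt_nhds ha] with t ht
  simp only [Function.comp_apply]
  rw [heq t ht, heq a ha]

theorem continuousAt_spectralDensity (hf : IsTestFunction f) (hg : IsTestFunction g) {a : ℝ}
    (ha : 0 < a) : ContinuousAt (spectralDensity f g) a := by
  have h : Tendsto (fun t : ℝ => t - a) (𝓝 a) (𝓝 0) := by
    have : Tendsto (fun t : ℝ => t - a) (𝓝 a) (𝓝 (a - a)) := Continuous.tendsto (by fun_prop) a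
    simpa using this
  have := (isBigO_spectralDensity hf hg ha).trans_tendsto h
  exact tendsto_sub_nhds_zero_iff.1 this

/-! ### The Fourier transform of the surface measure -/

theorem continuous_sphereMeasureHat (r : ℝ) :
    Continuous (sphereMeasureHat r : Euc n → ℂ) := by
  unfold sphereMeasureHat
  refine continuous_of_dominated (bound := fun _ => 1) (fun x => ?_) (fun x => ?_)
    (integrable_const _) (ae_of_all _ fun ξ => by fun_prop)
  · exact Continuous.aestronglyMeasurable (by fun_prop)
  · refine ae_of_all _ fun ξ => ?_
    rw [neg_mul, ← mul_neg, ← Complex.ofReal_neg, Complex.norm_exp_I_mul_ofReal]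

theorem integral_sphereMeasureHat_mul (r : ℝ) (hf : Integrable f volume) (x : Euc n) :
    ∫ y, sphereMeasureHat r (x - y) * f y =
      ∫ ξ, Complex.exp (-Complex.I * (inner ℝ x ξ : ℝ)) * oscIntegral f ξ
        ∂(sphereMeasure n r) := by
  have h1 : ∀ y, sphereMeasureHat r (x - y) * f y =
      ∫ ξ, Complex.exp (-Complex.I * (inner ℝ (x - y) ξ : ℝ)) * f y ∂(sphereMeasure n r) := by
    intro y
    rw [integral_mul_const]
    rfl
  simp only [h1]
  rw [integral_integral_swap]
  · refine integral_congr_ae (ae_of_all _ fun ξ => ?_)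
    simp only [oscIntegral]
    rw [← integral_const_mul]
    refine integral_congr_ae (ae_of_all _ fun y => ?_)
    simp only
    rw [← mul_assoc, ← Complex.exp_add, inner_sub_left]
    congr 2
    push_cast; ring
  · refine Integrable.bdd_mul (c := 1) (hf.comp_fst (sphereMeasure n r)) ?_ (ae_of_all _ fun p => ?_)
    · exact Continuous.aestronglyMeasurable (by fun_prop)
    · rw [neg_mul, ← mul_neg, ← Complex.ofReal_neg, Complex.norm_exp_I_mul_ofReal]

/-- The convolution is `T* T` for `T` the restriction of the transform to the sphere. Both exchanges
of integrals are justified by the finiteness of the surface measure. -/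
theorem pairing_integral_sphereMeasureHat_mul (r : ℝ) (hf : IsTestFunction f)
    (hg : IsTestFunction g) :
    pairing (fun x => ∫ y, sphereMeasureHat r (x - y) * f y) g =
      ∫ ξ, oscIntegral f ξ * conj (oscIntegral g ξ) ∂(sphereMeasure n r) := by
  have h1 : ∀ x, (∫ y, sphereMeasureHat r (x - y) * f y) * conj (g x) =
      ∫ ξ, Complex.exp (-Complex.I * (inner ℝ x ξ : ℝ)) * oscIntegral f ξ * conj (g x)
        ∂(sphereMeasure n r) := by
    intro x
    rw [integral_sphereMeasureHat_mul r hf.integrable, integral_mul_const]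
  rw [pairing]
  simp only [h1]
  rw [integral_integral_swap]
  · refine integral_congr_ae (ae_of_all _ fun ξ => ?_)
    simp only [oscIntegral]
    rw [← integral_conj, ← integral_const_mul]
    refine integral_congr_ae (ae_of_all _ fun y => ?_)
    simp only [map_mul, ← Complex.exp_conj, Complex.conj_I, Complex.conj_ofReal]
    ring
  · refine Integrable.bdd_mul (c := ∫ y, ‖f y‖)
      (hg.conj.integrable.comp_fst (sphereMeasure n r)) ?_ (ae_of_all _ fun p => ?_)
    · exact (Continuous.mul (by fun_prop)
        ((continuous_oscIntegral hf).comp continuous_snd)).aestronglyMeasurable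
    · rw [norm_mul, neg_mul, ← mul_neg, ← Complex.ofReal_neg, Complex.norm_exp_I_mul_ofReal,
        one_mul]
      exact norm_oscIntegral_le _

/-- Evaluation of the convolution at a point, bounded by the restriction to the sphere. -/
theorem norm_integral_sphereMeasureHat_mul_sq_le (r : ℝ) (hf : IsTestFunction f) (x : Euc n) :
    ‖∫ y, sphereMeasureHat r (x - y) * f y‖ ^ 2 ≤ (sphereMeasure n r).real Set.univ *
      ‖∫ ξ, oscIntegral f ξ * conj (oscIntegral f ξ) ∂(sphereMeasure n r)‖ := by
  set σ := sphereMeasure n r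
  have hFc := continuous_oscIntegral hf
  have hi2 : Integrable (fun ξ => ‖oscIntegral f ξ‖ ^ 2) σ := by
    refine Integrable.of_bound (C := (∫ y, ‖f y‖) ^ 2) (by fun_prop) (ae_of_all _ fun ξ => ?_)
    rw [norm_pow, norm_norm]
    gcongr
    exact norm_oscIntegral_le _
  have hmem : MemLp (fun ξ => ‖oscIntegral f ξ‖) (ENNReal.ofReal 2) σ := by
    rw [show ENNReal.ofReal 2 = 2 by simp]
    exact (memLp_two_iff_integrable_sq (by fun_prop)).2 hi2
  have h1 : ‖∫ y, sphereMeasureHat r (x - y) * f y‖ ≤ ∫ ξ, ‖oscIntegral f ξ‖ ∂σ := by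
    rw [integral_sphereMeasureHat_mul r hf.integrable]
    refine (norm_integral_le_integral_norm _).trans_eq ?_
    refine integral_congr_ae (ae_of_all _ fun ξ => ?_)
    simp only
    rw [norm_mul, neg_mul, ← mul_neg, ← Complex.ofReal_neg, Complex.norm_exp_I_mul_ofReal, one_mul]
  -- Cauchy–Schwarz against the constant `1`; the total mass of the sphere in the bound comes from
  -- here.
  have h2 := integral_mul_le_Lp_mul_Lq_of_nonneg (μ := σ) Real.HolderConjugate.two_two
    (f := fun _ => (1 : ℝ)) (g := fun ξ => ‖oscIntegral f ξ‖) (ae_of_all _ fun _ => zero_le_one)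
    (ae_of_all _ fun _ => norm_nonneg _) (memLp_const _) hmem
  simp only [one_mul, integral_const, smul_eq_mul, Real.rpow_two, one_pow, mul_one] at h2
  have h3 : ∫ ξ, oscIntegral f ξ * conj (oscIntegral f ξ) ∂σ =
      ((∫ ξ, ‖oscIntegral f ξ‖ ^ 2 ∂σ : ℝ) : ℂ) := by
    rw [← integral_complex_ofReal]
    refine integral_congr_ae (ae_of_all _ fun ξ => ?_)
    simp only
    rw [Complex.mul_conj']
    push_cast; rfl
  have h4 : 0 ≤ ∫ ξ, ‖oscIntegral f ξ‖ ^ 2 ∂σ := integral_nonneg fun _ => by positivity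
  rw [h3, Complex.norm_real, Real.norm_of_nonneg h4]
  calc _ ≤ (∫ ξ, ‖oscIntegral f ξ‖ ∂σ) ^ 2 := by gcongr
    _ ≤ _ := by
      refine (pow_le_pow_left₀ (integral_nonneg fun _ => norm_nonneg _) h2 2).trans_eq ?_
      rw [← Real.sqrt_eq_rpow, ← Real.sqrt_eq_rpow, mul_pow, Real.sq_sqrt h4,
        Real.sq_sqrt measureReal_nonneg]

end FourierSide

section WeightedSpaces

variable {n : ℕ} {V : Euc n → ℂ}

/-! ### The weighted spaces -/

theorem eLpNorm_two_sq {α F : Type*} [MeasurableSpace α] [NormedAddCommGroup F] (f : α → F)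
    (μ : Measure α) : eLpNorm f 2 μ ^ 2 = ∫⁻ x, ‖f x‖ₑ ^ 2 ∂μ := by
  have h := eLpNorm_nnreal_pow_eq_lintegral (μ := μ) (f := f) (p := 2) (by norm_num)
  simpa using h

theorem memLp_two_of_lintegral_lt_top {α F : Type*} [MeasurableSpace α] [NormedAddCommGroup F]
    {f : α → F} {μ : Measure α} (hf : AEStronglyMeasurable f μ) (h : ∫⁻ x, ‖f x‖ₑ ^ 2 ∂μ < (⊤ : ℝ≥0∞)) :
    MemLp f 2 μ := by
  refine ⟨hf, ?_⟩
  rw [← eLpNorm_two_sq] at h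
  by_contra! h2
  rw [top_le_iff.1 h2] at h
  simp at h

theorem eLpNorm_two_eq_of_lintegral_eq {α F G : Type*} [MeasurableSpace α] [NormedAddCommGroup F]
    [NormedAddCommGroup G] {f : α → F} {g : α → G} {μ ν : Measure α}
    (h : ∫⁻ x, ‖f x‖ₑ ^ 2 ∂μ = ∫⁻ x, ‖g x‖ₑ ^ 2 ∂ν) : eLpNorm f 2 μ = eLpNorm g 2 ν := by
  rw [← eLpNorm_two_sq, ← eLpNorm_two_sq] at h
  exact (ENNReal.pow_right_strictMono two_ne_zero).injective h

/-- The measure `|V| dx`. -/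
noncomputable abbrev absMeasure (V : Euc n → ℂ) : Measure (Euc n) := weightMeasure (fun x => ‖V x‖ₑ)

/-- The measure `|V|⁻¹ dx`. -/
noncomputable abbrev invMeasure (V : Euc n → ℂ) : Measure (Euc n) := weightMeasure (fun x => ‖V x‖ₑ⁻¹)

theorem absMeasure_absolutelyContinuous : absMeasure V ≪ volume :=
  withDensity_absolutelyContinuous _ _

theorem invMeasure_absolutelyContinuous : invMeasure V ≪ volume :=
  withDensity_absolutelyContinuous _ _

/-- The density `|V|⁻¹` never vanishes and is `∞` where `V = 0`, so a.e. statements pass freely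
between this measure and Lebesgue measure. For `|V| dx` they hold only on `{V ≠ 0}`. -/
theorem absolutelyContinuous_invMeasure (hV : AEMeasurable V volume) :
    volume ≪ invMeasure V :=
  withDensity_absolutelyContinuous' hV.enorm.inv
    (ae_of_all _ fun _ => ENNReal.inv_ne_zero.2 enorm_ne_top)

theorem ae_absMeasure_iff (hV : AEMeasurable V volume) {p : Euc n → Prop} :
    (∀ᵐ x ∂(absMeasure V), p x) ↔ ∀ᵐ x ∂volume, V x ≠ 0 → p x := by
  rw [ae_withDensity_iff' hV.enorm]
  simp

theorem lintegral_absMeasure (hV : AEMeasurable V volume) {F : Euc n → ℝ≥0∞}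
    (hF : AEMeasurable F (absMeasure V)) :
    ∫⁻ x, F x ∂(absMeasure V) = ∫⁻ x, ‖V x‖ₑ * F x := by
  rw [lintegral_withDensity_eq_lintegral_mul₀' hV.enorm hF]
  rfl

theorem lintegral_invMeasure (hV : AEMeasurable V volume) {F : Euc n → ℝ≥0∞}
    (hF : AEMeasurable F (invMeasure V)) :
    ∫⁻ x, F x ∂(invMeasure V) = ∫⁻ x, ‖V x‖ₑ⁻¹ * F x := by
  exact lintegral_withDensity_eq_lintegral_mul₀' hV.enorm.inv hF

/-- The weight is infinite on `{V = 0}`, so a finite norm leaves no room for nonzero values there.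
-/
theorem ae_eq_zero_of_memLp_invMeasure (hV : AEMeasurable V volume) {g : Euc n → ℂ}
    (hg : MemLp g 2 (invMeasure V)) : ∀ᵐ x ∂volume, V x = 0 → g x = 0 := by
  have hm : AEMeasurable (fun x => ‖g x‖ₑ ^ 2) (invMeasure V) := hg.1.enorm.pow_const 2
  have h1 : ∫⁻ x, ‖V x‖ₑ⁻¹ * ‖g x‖ₑ ^ 2 ≠ (⊤ : ℝ≥0∞) := by
    rw [← lintegral_invMeasure hV hm, ← eLpNorm_two_sq]
    exact ENNReal.pow_ne_top hg.2.ne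
  have hm2 : AEMeasurable (fun x => ‖V x‖ₑ⁻¹ * ‖g x‖ₑ ^ 2) volume :=
    hV.enorm.inv.mul ((hg.1.mono_ac (absolutelyContinuous_invMeasure hV)).enorm.pow_const 2)
  filter_upwards [ae_lt_top' hm2 h1] with x hx hVx
  by_contra hgx
  have : ‖g x‖ₑ ^ 2 ≠ 0 := by simpa using hgx
  simp [hVx, ENNReal.top_mul this] at hx

/-- An element of `L²(|V|)` is undetermined on `{V = 0}`, but `g` vanishes there. Hence the pairing
does not depend on the representative. -/
theorem mul_ae_eq_of_ae_eq_absMeasure (hV : AEMeasurable V volume) {u v : Euc n → ℂ}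
    (h : u =ᵐ[absMeasure V] v) (g : L2InvWeight V) :
    (fun x => u x * conj (g x)) =ᵐ[volume] fun x => v x * conj (g x) := by
  filter_upwards [(ae_absMeasure_iff hV).1 h, ae_eq_zero_of_memLp_invMeasure hV (Lp.memLp g)]
    with x h1 h2
  by_cases hx : V x = 0
  · simp [h2 hx]
  · rw [h1 hx]

theorem pairing_congr_left (hV : AEMeasurable V volume) {u v : Euc n → ℂ}
    (h : u =ᵐ[absMeasure V] v) (g : L2InvWeight V) : pairing u g = pairing v g :=
  integral_congr_ae (mul_ae_eq_of_ae_eq_absMeasure hV h g)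

/-- Pointwise `|V|⁻¹ (|V| |u|)² = |V| |u|²`, also where `V = 0`, by the convention `∞ * 0 = 0`. -/
theorem lintegral_norm_mul_sq (hV : AEMeasurable V volume) {u : Euc n → ℂ}
    (hu : AEStronglyMeasurable u volume) :
    ∫⁻ x, ‖(‖V x‖ : ℂ) * u x‖ₑ ^ 2 ∂(invMeasure V) = ∫⁻ x, ‖u x‖ₑ ^ 2 ∂(absMeasure V) := by
  have hm : AEMeasurable (fun x => ‖(‖V x‖ : ℂ) * u x‖ₑ ^ 2) volume :=
    ((Complex.measurable_ofReal.comp_aemeasurable hV.norm).mul hu.aemeasurable).enorm.pow_const 2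
  rw [lintegral_invMeasure hV (hm.mono_ac invMeasure_absolutelyContinuous),
    lintegral_absMeasure hV ((hu.enorm.pow_const 2).mono_ac absMeasure_absolutelyContinuous)]
  refine lintegral_congr fun x => ?_
  have h1 : ‖(‖V x‖ : ℂ)‖ₑ = ‖V x‖ₑ := by
    rw [← ofReal_norm, ← ofReal_norm, Complex.norm_real, norm_norm]
  rw [enorm_mul, h1, mul_pow, ← mul_assoc, sq ‖V x‖ₑ, ← mul_assoc]
  congr 1
  by_cases hx : ‖V x‖ₑ = 0
  · simp [hx]
  · rw [ENNReal.inv_mul_cancel hx enorm_ne_top, one_mul]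

theorem aestronglyMeasurable_norm_mul (hV : AEMeasurable V volume) {u : Euc n → ℂ}
    (hu : AEStronglyMeasurable u volume) :
    AEStronglyMeasurable (fun x => (‖V x‖ : ℂ) * u x) volume :=
  (Complex.measurable_ofReal.comp_aemeasurable hV.norm).aestronglyMeasurable.mul hu

theorem memLp_norm_mul (hV : AEMeasurable V volume) (u : L2Weight V) :
    MemLp (fun x => (‖V x‖ : ℂ) * u x) 2 (invMeasure V) := by
  -- The chosen representative is strongly measurable everywhere, hence also for Lebesgue measure on
  -- the set that `|V| dx` does not see.
  have hu : AEStronglyMeasurable u volume := (Lp.stronglyMeasurable u).aestronglyMeasurable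
  refine memLp_two_of_lintegral_lt_top
    ((aestronglyMeasurable_norm_mul hV hu).mono_ac invMeasure_absolutelyContinuous) ?_
  rw [lintegral_norm_mul_sq hV hu, ← eLpNorm_two_sq]
  exact ENNReal.pow_lt_top (Lp.eLpNorm_lt_top u)

/-- Multiplication by `|V|` as an isometry. -/
noncomputable def normMulIsometry (hV : AEMeasurable V volume) :
    L2Weight V →ₗᵢ[ℂ] L2InvWeight V where
  toFun u := (memLp_norm_mul hV u).toLp _
  map_add' u v := by
    rw [← MemLp.toLp_add]
    refine MemLp.toLp_congr _ _ (invMeasure_absolutelyContinuous.ae_le ?_)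
    filter_upwards [(ae_absMeasure_iff hV).1 (Lp.coeFn_add u v)] with x h
    by_cases hx : V x = 0
    · simp [hx]
    · simp only [h hx, Pi.add_apply, mul_add]
  map_smul' c u := by
    rw [RingHom.id_apply, ← MemLp.toLp_const_smul]
    refine MemLp.toLp_congr _ _ (invMeasure_absolutelyContinuous.ae_le ?_)
    filter_upwards [(ae_absMeasure_iff hV).1 (Lp.coeFn_smul c u)] with x h
    by_cases hx : V x = 0
    · simp [hx]
    · simp only [h hx, Pi.smul_apply, smul_eq_mul, mul_left_comm]
  norm_map' u := by
    change ‖(memLp_norm_mul hV u).toLp _‖ = ‖u‖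
    rw [Lp.norm_toLp, Lp.norm_def]
    congr 1
    exact eLpNorm_two_eq_of_lintegral_eq
      (lintegral_norm_mul_sq hV (Lp.stronglyMeasurable u).aestronglyMeasurable)

theorem coeFn_normMulIsometry (hV : AEMeasurable V volume) (u : L2Weight V) :
    normMulIsometry hV u =ᵐ[volume] fun x => (‖V x‖ : ℂ) * u x :=
  (absolutelyContinuous_invMeasure hV).ae_le (memLp_norm_mul hV u).coeFn_toLp

theorem surjective_normMulIsometry (hV : AEMeasurable V volume) :
    Function.Surjective (normMulIsometry hV) := by
  intro g
  -- The preimage is `g / |V|`. The real inverse gives `0` where `V = 0`, which is consistent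
  -- because `g` vanishes there.
  set v : Euc n → ℂ := fun x => ((‖V x‖⁻¹ : ℝ) : ℂ) * g x with hv
  have hvm : AEStronglyMeasurable v volume :=
    (Complex.measurable_ofReal.comp_aemeasurable hV.norm.inv).aestronglyMeasurable.mul
      (Lp.stronglyMeasurable g).aestronglyMeasurable
  have hgv : (fun x => (‖V x‖ : ℂ) * v x) =ᵐ[volume] g := by
    filter_upwards [ae_eq_zero_of_memLp_invMeasure hV (Lp.memLp g)] with x h
    by_cases hx : V x = 0
    · simp [hx, h hx]
    · have : (‖V x‖ : ℂ) ≠ 0 := by simpa using hx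
      simp only [hv, Complex.ofReal_inv]
      rw [mul_inv_cancel_left₀ this]
  have hvL : MemLp v 2 (absMeasure V) := by
    refine memLp_two_of_lintegral_lt_top (hvm.mono_ac absMeasure_absolutelyContinuous) ?_
    rw [← lintegral_norm_mul_sq hV hvm, ← eLpNorm_two_sq,
      eLpNorm_congr_ae (invMeasure_absolutelyContinuous.ae_le hgv)]
    exact ENNReal.pow_lt_top (Lp.eLpNorm_lt_top g)
  refine ⟨hvL.toLp v, ?_⟩
  refine Lp.ext (invMeasure_absolutelyContinuous.ae_le ?_)
  refine (coeFn_normMulIsometry hV _).trans (EventuallyEq.trans ?_ hgv)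
  filter_upwards [(ae_absMeasure_iff hV).1 hvL.coeFn_toLp] with x h
  by_cases hx : V x = 0
  · simp [hx]
  · rw [h hx]

/-- Multiplication by `|V|` identifies `L²(|V|)` with `L²(|V|⁻¹)`. -/
noncomputable def normMulEquiv (hV : AEMeasurable V volume) :
    L2Weight V ≃ₗᵢ[ℂ] L2InvWeight V :=
  LinearIsometryEquiv.ofSurjective (normMulIsometry hV) (surjective_normMulIsometry hV)

theorem norm_mul_pairing_ae (hV : AEMeasurable V volume) (u : L2Weight V) (g : L2InvWeight V) :
    (fun x => u x * conj (g x)) =ᵐ[volume]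
      fun x => ‖V x‖ₑ.toReal • inner ℂ ((normMulEquiv hV).symm g x) (u x) := by
  obtain ⟨v, rfl⟩ := (normMulEquiv hV).surjective g
  rw [LinearIsometryEquiv.symm_apply_apply]
  filter_upwards [coeFn_normMulIsometry hV v] with x hx
  have hx' : (normMulEquiv hV v) x = (‖V x‖ : ℂ) * v x := hx
  rw [hx', toReal_enorm, Complex.real_smul, RCLike.inner_apply, map_mul, Complex.conj_ofReal]
  ring

/-- Makes the duality between the weighted spaces a Hilbert space inner product, so that
Cauchy–Schwarz and Riesz representation apply. -/
theorem pairing_eq_inner (hV : AEMeasurable V volume) (u : L2Weight V) (g : L2InvWeight V) :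
    pairing u g = inner ℂ ((normMulEquiv hV).symm g) u := by
  rw [L2.inner_def, integral_withDensity_eq_integral_toReal_smul₀ hV.enorm
    (ae_of_all _ fun x => enorm_lt_top)]
  exact integral_congr_ae (norm_mul_pairing_ae hV u g)

theorem integrable_mul_conj (hV : AEMeasurable V volume) (u : L2Weight V) (g : L2InvWeight V) :
    Integrable (fun x => u x * conj (g x)) volume := by
  have h := L2.integrable_inner (𝕜 := ℂ) ((normMulEquiv hV).symm g) u
  rw [integrable_withDensity_iff_integrable_smul₀' hV.enorm (ae_of_all _ fun x => enorm_lt_top)]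
    at h
  exact h.congr (norm_mul_pairing_ae hV u g).symm

theorem norm_pairing_le (hV : AEMeasurable V volume) (u : L2Weight V) (g : L2InvWeight V) :
    ‖pairing u g‖ ≤ ‖u‖ * ‖g‖ := by
  rw [pairing_eq_inner hV, mul_comm]
  refine (norm_inner_le_norm _ _).trans_eq ?_
  rw [LinearIsometryEquiv.norm_map]

/-! ### Density of the test functions -/

theorem IsTestFunction.congr_ae {f g : Euc n → ℂ} (hf : IsTestFunction f) (h : f =ᵐ[volume] g) :
    IsTestFunction g where
  memLp := hf.memLp.ae_eq h
  integrable := hf.integrable.congr h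
  integrable_norm_mul := hf.integrable_norm_mul.congr (h.mono fun x hx => by simp only [hx])

theorem isTestFunction_of_bounded {f : Euc n → ℂ} (hf : AEStronglyMeasurable f volume) {M R : ℝ}
    (hM : ∀ x, ‖f x‖ ≤ M) (hR : ∀ x, R < ‖x‖ → f x = 0) : IsTestFunction f := by
  -- The codomain is left free: this serves both the complex function `f` and the real function `‖y‖
  -- * ‖f y‖`.
  have key : ∀ {F : Type} [NormedAddCommGroup F] (φ : Euc n → F) (N : ℝ),
      AEStronglyMeasurable φ volume → (∀ x, ‖φ x‖ ≤ N) → (∀ x, R < ‖x‖ → φ x = 0) →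
      ∀ p : ℝ≥0∞, MemLp φ p volume := by
    intro F _ φ N hφ hN hφR p
    have h1 : φ = (Metric.closedBall (0 : Euc n) R).indicator φ := by
      ext x
      by_cases h : x ∈ Metric.closedBall (0 : Euc n) R
      · rw [Set.indicator_of_mem h]
      · rw [Set.indicator_of_notMem h]
        exact hφR x (by simpa using h)
    rw [h1, memLp_indicator_iff_restrict Metric.isClosed_closedBall.measurableSet]
    have : IsFiniteMeasure (volume.restrict (Metric.closedBall (0 : Euc n) R)) :=
      isFiniteMeasure_restrict.2 (measure_closedBall_lt_top).ne
    exact MemLp.of_bound hφ.restrict N (ae_of_all _ hN)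
  refine ⟨key f M hf hM hR 2, memLp_one_iff_integrable.1 (key f M hf hM hR 1),
    memLp_one_iff_integrable.1 (key _ (|R| * M) ?_ (fun x => ?_) (fun x hx => ?_) 1)⟩
  · exact continuous_norm.aestronglyMeasurable.mul hf.norm
  · have hM0 : 0 ≤ M := (norm_nonneg _).trans (hM x)
    rw [norm_mul, norm_norm, norm_norm]
    by_cases hx : R < ‖x‖
    · rw [hR x hx, norm_zero, mul_zero]; positivity
    · exact mul_le_mul ((not_lt.1 hx).trans (le_abs_self R)) (hM x) (norm_nonneg _) (abs_nonneg _)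
  · rw [hR x hx, norm_zero, mul_zero]

/-- The truncation of `f` to a ball and to small values. -/
noncomputable def truncate (f : Euc n → ℂ) (k : ℕ) : Euc n → ℂ :=
  {x | ‖f x‖ ≤ k ∧ ‖x‖ ≤ k}.indicator f

theorem stronglyMeasurable_truncate {f : Euc n → ℂ} (hf : StronglyMeasurable f) (k : ℕ) :
    StronglyMeasurable (truncate f k) :=
  hf.indicator ((measurableSet_le hf.norm.measurable measurable_const).inter
    (measurableSet_le measurable_norm measurable_const))

theorem isTestFunction_truncate {f : Euc n → ℂ} (hf : StronglyMeasurable f) (k : ℕ) :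
    IsTestFunction (truncate f k) := by
  refine isTestFunction_of_bounded (M := k) (R := k)
    (stronglyMeasurable_truncate hf k).aestronglyMeasurable (fun x => ?_) (fun x hx => ?_)
  · rw [truncate, Set.indicator_apply]
    split_ifs with h
    · exact h.1
    · simp
  · rw [truncate, Set.indicator_of_notMem]
    exact fun h => absurd h.2 (not_le.2 hx)

theorem norm_truncate_le (f : Euc n → ℂ) (k : ℕ) (x : Euc n) : ‖truncate f k x‖ ≤ ‖f x‖ :=
  norm_indicator_le_norm_self _ _

theorem eventually_truncate_eq (f : Euc n → ℂ) (x : Euc n) :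
    ∀ᶠ k : ℕ in atTop, truncate f k x = f x := by
  filter_upwards [tendsto_natCast_atTop_atTop.eventually_ge_atTop (‖f x‖ : ℝ),
    tendsto_natCast_atTop_atTop.eventually_ge_atTop (‖x‖ : ℝ)] with k h1 h2
  rw [truncate, Set.indicator_of_mem]
  exact ⟨h1, h2⟩

theorem memLp_truncate {f : Euc n → ℂ} (hf : StronglyMeasurable f) {μ : Measure (Euc n)}
    (h : MemLp f 2 μ) (k : ℕ) : MemLp (truncate f k) 2 μ :=
  h.mono (stronglyMeasurable_truncate hf k).aestronglyMeasurable
    (ae_of_all _ (norm_truncate_le f k))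

/-- The measure is arbitrary so that one sequence of truncations converges in `L²(|V|⁻¹)` and in
`L²` at once. -/
theorem tendsto_truncate {f : Euc n → ℂ} (hf : StronglyMeasurable f) {μ : Measure (Euc n)}
    (h : MemLp f 2 μ) :
    Tendsto (fun k => (memLp_truncate hf h k).toLp) atTop (𝓝 (h.toLp f)) := by
  rw [Lp.tendsto_Lp_iff_tendsto_eLpNorm'']
  have h1 : Tendsto (fun k : ℕ => ∫⁻ x, ‖(truncate f k - f) x‖ₑ ^ 2 ∂μ) atTop
      (𝓝 (∫⁻ _, 0 ∂μ)) := by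
    refine tendsto_lintegral_of_dominated_convergence' (fun x => ‖f x‖ₑ ^ 2)
      (fun k => ((stronglyMeasurable_truncate hf k).sub hf).enorm.pow_const 2 |>.aemeasurable)
      (fun k => ae_of_all _ fun x => ?_) ?_ (ae_of_all _ fun x => ?_)
    · simp only [Pi.sub_apply, truncate, Set.indicator_apply]
      split_ifs <;> simp
    · rw [← eLpNorm_two_sq]
      exact ENNReal.pow_ne_top h.2.ne
    · refine tendsto_const_nhds.congr' ?_
      filter_upwards [eventually_truncate_eq f x] with k hk
      simp [hk]
  simp only [lintegral_zero, ← eLpNorm_two_sq] at h1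
  have h2 := h1.ennrpow_const (1 / 2 : ℝ)
  rw [ENNReal.zero_rpow_of_pos (by norm_num)] at h2
  refine h2.congr fun k => ?_
  rw [← ENNReal.rpow_natCast, ← ENNReal.rpow_mul]
  norm_num

/-- Approximation by test functions in `L²(|V|⁻¹)` and simultaneously in `L²`. -/
theorem exists_seq_isTestFunction (hV : AEMeasurable V volume) (f : L2InvWeight V) :
    ∃ (u : ℕ → L2InvWeight V) (hu : ∀ k, IsTestFunction (u k)), Tendsto u atTop (𝓝 f) ∧
      ∀ hf : MemLp f 2 volume,
        Tendsto (fun k => (hu k).memLp.toLp (u k)) atTop (𝓝 (hf.toLp f)) := by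
  have hs := Lp.stronglyMeasurable f
  have hae : ∀ k, (memLp_truncate hs (Lp.memLp f) k).toLp =ᵐ[volume] truncate f k := fun k =>
    (absolutelyContinuous_invMeasure hV).ae_le (memLp_truncate hs (Lp.memLp f) k).coeFn_toLp
  refine ⟨fun k => (memLp_truncate hs (Lp.memLp f) k).toLp,
    fun k => (isTestFunction_truncate hs k).congr_ae (hae k).symm, ?_, fun hf => ?_⟩
  · simpa only [Lp.toLp_coeFn] using tendsto_truncate hs (Lp.memLp f)
  · refine (tendsto_truncate hs hf).congr fun k => ?_
    exact MemLp.toLp_congr _ _ (hae k).symm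

theorem dense_isTestFunction (hV : AEMeasurable V volume) :
    Dense {f : L2InvWeight V | IsTestFunction f} := by
  intro f
  obtain ⟨u, hu, hlim, -⟩ := exists_seq_isTestFunction hV f
  exact mem_closure_of_tendsto hlim (Eventually.of_forall hu)

/-! ### Duality -/

/-- A function whose pairing with test functions is bounded lies in `L²(|V|)`. -/
theorem eLpNorm_le_of_norm_pairing_le (hV : AEMeasurable V volume) {u : Euc n → ℂ}
    (hu : AEStronglyMeasurable u volume) {K : ℝ}
    (hK : 0 ≤ K) (h : ∀ g : L2InvWeight V, IsTestFunction g → ‖pairing u g‖ ≤ K * ‖g‖) :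
    eLpNorm u 2 (absMeasure V) ≤ ENNReal.ofReal K := by
  -- On `A k` all of `u`, `V` and `x` are bounded, so `|V| u` cut off to `A k` is a test function
  -- even though nothing is known about the size of `u`.
  set A : ℕ → Set (Euc n) := fun k => {x | ‖u x‖ ≤ k ∧ ‖V x‖ ≤ k ∧ ‖x‖ ≤ k} with hA
  have hAm : ∀ k, NullMeasurableSet (A k) volume := fun k =>
    (nullMeasurableSet_le hu.norm.aemeasurable aemeasurable_const).inter
      ((nullMeasurableSet_le hV.norm aemeasurable_const).inter
        (nullMeasurableSet_le measurable_norm.aemeasurable aemeasurable_const))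
  set w : ℕ → Euc n → ℂ := fun k => (A k).indicator u with hw
  have hwm : ∀ k, AEStronglyMeasurable (w k) volume := fun k => hu.indicator₀ (hAm k)
  -- The extremal function for the duality: pairing `u` with `φ k` gives the square of the norm of
  -- `w k`, while the norm of `φ k` equals that of `w k`.
  set φ : ℕ → Euc n → ℂ := fun k x => (‖V x‖ : ℂ) * w k x with hφ
  have hφm : ∀ k, AEStronglyMeasurable (φ k) volume := fun k =>
    aestronglyMeasurable_norm_mul hV (hwm k)
  have hφt : ∀ k, IsTestFunction (φ k) := by
    intro k
    refine isTestFunction_of_bounded (M := k * k) (R := k) (hφm k) (fun x => ?_) (fun x hx => ?_)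
    · simp only [hφ, hw, norm_mul, Complex.norm_real, norm_norm]
      by_cases hx : x ∈ A k
      · rw [Set.indicator_of_mem hx]
        exact mul_le_mul hx.2.1 hx.1 (norm_nonneg _) (Nat.cast_nonneg _)
      · rw [Set.indicator_of_notMem hx, norm_zero, mul_zero]
        positivity
    · simp only [hφ, hw]
      rw [Set.indicator_of_notMem (fun h => absurd h.2.2 (not_le.2 hx)), mul_zero]
  have hwint : ∀ k, Integrable (fun x => ‖V x‖ * ‖w k x‖ ^ 2) volume := by
    intro k
    have h1 : Integrable (fun x => (k : ℝ) * ‖φ k x‖) volume := (hφt k).integrable.norm.const_mul _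
    refine h1.mono' (hV.norm.aestronglyMeasurable.mul ((hwm k).norm.pow 2))
      (ae_of_all _ fun x => ?_)
    simp only [hφ, norm_mul, Complex.norm_real, norm_norm, norm_pow]
    have h2 : ‖w k x‖ ≤ k := by
      simp only [hw]
      by_cases hx : x ∈ A k
      · rw [Set.indicator_of_mem hx]; exact hx.1
      · rw [Set.indicator_of_notMem hx, norm_zero]; exact Nat.cast_nonneg _
    calc ‖V x‖ * ‖w k x‖ ^ 2 = ‖w k x‖ * (‖V x‖ * ‖w k x‖) := by ring
      _ ≤ _ := by gcongr
  have hwl : ∀ k, ∫⁻ x, ‖w k x‖ₑ ^ 2 ∂(absMeasure V) =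
      ENNReal.ofReal (∫ x, ‖V x‖ * ‖w k x‖ ^ 2) := by
    intro k
    rw [ofReal_integral_eq_lintegral_ofReal (hwint k) (ae_of_all _ fun x => by positivity),
      lintegral_absMeasure hV (((hwm k).enorm.pow_const 2).mono_ac absMeasure_absolutelyContinuous)]
    refine lintegral_congr fun x => ?_
    rw [ENNReal.ofReal_mul (norm_nonneg _), ENNReal.ofReal_pow (norm_nonneg _), ofReal_norm,
      ofReal_norm]
  have hφL : ∀ k, MemLp (φ k) 2 (invMeasure V) := by
    intro k
    refine memLp_two_of_lintegral_lt_top ((hφm k).mono_ac invMeasure_absolutelyContinuous) ?_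
    simp only [hφ]
    rw [lintegral_norm_mul_sq hV (hwm k), hwl]
    exact ENNReal.ofReal_lt_top
  have hbound : ∀ k, eLpNorm (w k) 2 (absMeasure V) ≤ ENNReal.ofReal K := by
    intro k
    set I : ℝ := ∫ x, ‖V x‖ * ‖w k x‖ ^ 2 with hI
    have hI0 : 0 ≤ I := integral_nonneg fun x => by positivity
    have hnorm : eLpNorm (w k) 2 (absMeasure V) = ENNReal.ofReal √I := by
      have h1 := eLpNorm_two_sq (w k) (absMeasure V)
      rw [hwl, ← hI, ← Real.sq_sqrt hI0, ENNReal.ofReal_pow (Real.sqrt_nonneg _)] at h1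
      exact (ENNReal.pow_right_strictMono two_ne_zero).injective h1
    have hgn : ‖(hφL k).toLp (φ k)‖ = √I := by
      rw [Lp.norm_toLp, eLpNorm_two_eq_of_lintegral_eq (lintegral_norm_mul_sq hV (hwm k)), hnorm,
        ENNReal.toReal_ofReal (Real.sqrt_nonneg _)]
    have hae : (hφL k).toLp (φ k) =ᵐ[volume] φ k :=
      (absolutelyContinuous_invMeasure hV).ae_le (hφL k).coeFn_toLp
    have hp : pairing u ((hφL k).toLp (φ k)) = (I : ℂ) := by
      rw [hI, ← integral_complex_ofReal, pairing]
      refine integral_congr_ae ?_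
      filter_upwards [hae] with x hx
      rw [hx]
      simp only [hφ, hw, map_mul, Complex.conj_ofReal]
      by_cases hxA : x ∈ A k
      · rw [Set.indicator_of_mem hxA, mul_left_comm, Complex.mul_conj']
        push_cast; rfl
      · simp [Set.indicator_of_notMem hxA]
    have h1 := h _ ((hφt k).congr_ae hae.symm)
    rw [hp, hgn, Complex.norm_real, Real.norm_of_nonneg hI0] at h1
    rw [hnorm]
    refine ENNReal.ofReal_le_ofReal ?_
    -- The hypothesis now reads `I ≤ K √I`; divide by `√I` unless it is zero.
    rcases (Real.sqrt_nonneg I).eq_or_lt' with h0 | h0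
    · rwa [h0]
    · nth_rewrite 1 [← Real.mul_self_sqrt hI0] at h1
      exact le_of_mul_le_mul_right h1 h0
  have hlim : ∀ x, Tendsto (fun k => w k x) atTop (𝓝 (u x)) := by
    intro x
    refine tendsto_const_nhds.congr' ?_
    filter_upwards [tendsto_natCast_atTop_atTop.eventually_ge_atTop (‖u x‖ : ℝ),
      tendsto_natCast_atTop_atTop.eventually_ge_atTop (‖V x‖ : ℝ),
      tendsto_natCast_atTop_atTop.eventually_ge_atTop (‖x‖ : ℝ)] with k h1 h2 h3
    simp only [hw]
    rw [Set.indicator_of_mem]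
    exact ⟨h1, h2, h3⟩
  -- Fatou removes the cutoff.
  refine (Lp.eLpNorm_lim_le_liminf_eLpNorm
    (fun k => (hwm k).mono_ac absMeasure_absolutelyContinuous) u (ae_of_all _ hlim)).trans ?_
  refine (liminf_le_liminf (Eventually.of_forall hbound)).trans_eq ?_
  simp

theorem norm_lp_le_of_eLpNorm_le {α F : Type*} [MeasurableSpace α] [NormedAddCommGroup F]
    {μ : Measure α} {p : ℝ≥0∞} {f : α → F} (hf : MemLp f p μ) {K : ℝ} (hK : 0 ≤ K)
    (h : eLpNorm f p μ ≤ ENNReal.ofReal K) : ‖hf.toLp f‖ ≤ K := by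
  rw [Lp.norm_toLp]
  exact ENNReal.toReal_le_of_le_ofReal hK h

/-! ### Extension of operators -/

/-- An operator on `L²` that is bounded in the weighted norms on `L² ∩ L²(|V|⁻¹)`
extends uniquely. -/
theorem exists_isWeightedExtension (hV : AEMeasurable V volume) (A : L2 n →L[ℂ] L2 n) {K : ℝ}
    (hK : 0 ≤ K) (hA : ∀ (f : L2InvWeight V) (hf : MemLp f 2 volume),
      eLpNorm (A (hf.toLp f)) 2 (absMeasure V) ≤ ENNReal.ofReal (K * ‖f‖)) :
    ∃ T, IsWeightedExtension V A T ∧ (∀ f, ‖T f‖ ≤ K * ‖f‖) ∧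
      ∀ T', IsWeightedExtension V A T' → T' = T := by
  have hvol : ∀ {φ ψ : Euc n → ℂ}, φ =ᵐ[invMeasure V] ψ → φ =ᵐ[volume] ψ := fun h =>
    (absolutelyContinuous_invMeasure hV).ae_le h
  let S : Submodule ℂ (L2InvWeight V) :=
    { carrier := {f | MemLp f 2 volume}
      add_mem' := fun {f g} hf hg => (MemLp.add hf hg).ae_eq (hvol (Lp.coeFn_add f g)).symm
      zero_mem' := MemLp.zero.ae_eq (hvol (Lp.coeFn_zero ℂ 2 (invMeasure V))).symm
      smul_mem' := fun c f hf => (MemLp.const_smul hf c).ae_eq (hvol (Lp.coeFn_smul c f)).symm }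
  have hmem : ∀ f : S, MemLp (A (f.2.toLp (f : L2InvWeight V))) 2 (absMeasure V) := fun f =>
    ⟨(Lp.aestronglyMeasurable _).mono_ac absMeasure_absolutelyContinuous,
      (hA f.1 f.2).trans_lt ENNReal.ofReal_lt_top⟩
  let T₀ : S →ₗ[ℂ] L2Weight V :=
    { toFun := fun f => (hmem f).toLp _
      map_add' := fun f g => by
        rw [← MemLp.toLp_add]
        refine MemLp.toLp_congr _ _ (absMeasure_absolutelyContinuous.ae_le ?_)
        have h1 : (f + g).2.toLp ((f + g : S) : L2InvWeight V) =
            f.2.toLp (f : L2InvWeight V) + g.2.toLp (g : L2InvWeight V) := by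
          rw [← MemLp.toLp_add]
          exact MemLp.toLp_congr _ _ (hvol (Lp.coeFn_add f.1 g.1))
        rw [h1, map_add]
        exact Lp.coeFn_add _ _
      map_smul' := fun c f => by
        rw [RingHom.id_apply, ← MemLp.toLp_const_smul]
        refine MemLp.toLp_congr _ _ (absMeasure_absolutelyContinuous.ae_le ?_)
        have h1 : (c • f).2.toLp ((c • f : S) : L2InvWeight V) =
            c • f.2.toLp (f : L2InvWeight V) := by
          rw [← MemLp.toLp_const_smul]
          exact MemLp.toLp_congr _ _ (hvol (Lp.coeFn_smul c f.1))
        rw [h1, map_smul]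
        exact Lp.coeFn_smul _ _ }
  have hdense : DenseRange S.subtype := by
    rw [DenseRange, Submodule.coe_subtype, Subtype.range_coe]
    exact (dense_isTestFunction hV).mono fun f hf => IsTestFunction.memLp hf
  have hbd : ∀ f, ‖T₀ f‖ ≤ K * ‖S.subtype f‖ := fun f =>
    norm_lp_le_of_eLpNorm_le (hmem f) (by positivity) (hA f.1 f.2)
  refine ⟨T₀.extendOfNorm S.subtype, fun f hf => ?_,
    LinearMap.norm_extendOfNorm_apply_le hdense K hbd, fun T' hT' => ?_⟩
  · have := LinearMap.extendOfNorm_eq hdense ⟨K, hbd⟩ ⟨f, hf⟩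
    have h1 : T₀.extendOfNorm S.subtype f = (hmem ⟨f, hf⟩).toLp _ := this
    rw [h1]
    exact (hmem ⟨f, hf⟩).coeFn_toLp
  · refine (LinearMap.extendOfNorm_unique hdense K hbd T' ?_).symm
    ext1 f
    exact Lp.ext ((hT' f.1 f.2).trans (hmem f).coeFn_toLp.symm)

theorem weightedExtension_spec {A : L2 n → L2 n} (h : ∃ T, IsWeightedExtension V A T) :
    IsWeightedExtension V A (weightedExtension V A) := by
  rw [weightedExtension, dif_pos h]
  exact h.choose_spec

theorem pairing_eq_inner_toLp {g : Euc n → ℂ} (u : L2 n) (hg : MemLp g 2 volume) :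
    pairing u g = inner ℂ (hg.toLp g : L2 n) u := by
  rw [← integral_mul_conj_eq_inner, pairing]
  refine integral_congr_ae ?_
  filter_upwards [hg.coeFn_toLp] with x hx
  rw [hx]

/-- Bounds for the sesquilinear form on test functions give bounds for the operator. -/
theorem eLpNorm_le_of_norm_pairing_testFunction_le (hV : AEMeasurable V volume)
    (A : L2 n →L[ℂ] L2 n) {K : ℝ} (hK : 0 ≤ K)
    (h : ∀ (f g : L2InvWeight V) (hf : IsTestFunction f), IsTestFunction g →
      ‖pairing (A (hf.memLp.toLp f)) g‖ ≤ K * ‖f‖ * ‖g‖)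
    (f : L2InvWeight V) (hf : MemLp f 2 volume) :
    eLpNorm (A (hf.toLp f)) 2 (absMeasure V) ≤ ENNReal.ofReal (K * ‖f‖) := by
  refine eLpNorm_le_of_norm_pairing_le hV (Lp.aestronglyMeasurable _) (by positivity)
    fun g hg => ?_
  -- Both modes of convergence are needed: the left side is continuous in the `L²` norm, the right
  -- side in the weighted norm.
  obtain ⟨u, hu, hlim, hlim2⟩ := exists_seq_isTestFunction hV f
  rw [pairing_eq_inner_toLp _ hg.memLp]
  have h1 := (tendsto_const_nhds (x := (hg.memLp.toLp g : L2 n))).inner (𝕜 := ℂ)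
    ((A.continuous.tendsto _).comp (hlim2 hf))
  refine le_of_tendsto_of_tendsto h1.norm ((hlim.norm.const_mul K).mul_const ‖g‖)
    (Eventually.of_forall fun k => ?_)
  simp only [Function.comp_apply]
  rw [← pairing_eq_inner_toLp]
  exact h _ _ (hu k) hg

/-! ### Weak limits of bounded families of operators -/

theorem tendsto_zero_of_dense {X : Type*} [SeminormedAddCommGroup X] {D : Set X} (hD : Dense D)
    {ι : Type*} {l : Filter ι} {φ : X → ι → ℂ} {M : ℝ}
    (hφ : ∀ x y, ∀ᶠ i in l, ‖φ x i - φ y i‖ ≤ M * ‖x - y‖)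
    (h : ∀ x ∈ D, Tendsto (φ x) l (𝓝 0)) (x : X) : Tendsto (φ x) l (𝓝 0) := by
  rw [Metric.tendsto_nhds]
  intro δ hδ
  -- `M` carries no sign, so `|M| + 1` is used as a positive denominator.
  have hM : 0 < |M| + 1 := by positivity
  obtain ⟨y, hyD, hy⟩ := Metric.mem_closure_iff.1 (hD x) (δ / 2 / (|M| + 1)) (by positivity)
  filter_upwards [hφ x y, Metric.tendsto_nhds.1 (h y hyD) (δ / 2) (by positivity)] with i h1 h2
  rw [dist_zero_right] at h2 ⊢
  rw [dist_eq_norm, lt_div_iff₀ hM] at hy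
  have h3 : M * ‖x - y‖ ≤ ‖x - y‖ * (|M| + 1) := by
    nlinarith [norm_nonneg (x - y), le_abs_self M]
  calc ‖φ x i‖ = ‖(φ x i - φ y i) + φ y i‖ := by rw [sub_add_cancel]
    _ ≤ ‖φ x i - φ y i‖ + ‖φ y i‖ := norm_add_le _ _
    _ < δ := by linarith

variable {X Y : Type*} [NormedAddCommGroup X] [InnerProductSpace ℂ X]
  [NormedAddCommGroup Y] [InnerProductSpace ℂ Y]

/-- The differences `T i - L` are bounded by `2 K`, so density can be used twice, first in `y` for
fixed `x ∈ D` and then in `x`. -/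
theorem tendsto_inner_of_dense {ι : Type*} {l : Filter ι} {T : ι → X →L[ℂ] Y} {L : X →L[ℂ] Y}
    {K : ℝ} (hT : ∀ᶠ i in l, ∀ x, ‖T i x‖ ≤ K * ‖x‖) (hL : ∀ x, ‖L x‖ ≤ K * ‖x‖)
    {D : Set X} (hD : Dense D) {D' : Set Y} (hD' : Dense D')
    (h : ∀ x ∈ D, ∀ y ∈ D', Tendsto (fun i => inner ℂ y (T i x)) l (𝓝 (inner ℂ y (L x))))
    (x : X) (y : Y) : Tendsto (fun i => inner ℂ y (T i x)) l (𝓝 (inner ℂ y (L x))) := by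
  have hb : ∀ (i : ι) (x : X), (∀ x, ‖T i x‖ ≤ K * ‖x‖) → ‖T i x - L x‖ ≤ 2 * K * ‖x‖ := by
    intro i x hi
    refine (norm_sub_le _ _).trans ?_
    linarith [hi x, hL x]
  have h0 : ∀ x ∈ D, ∀ y, Tendsto (fun i => inner ℂ y (T i x - L x)) l (𝓝 0) := by
    intro x hx
    refine tendsto_zero_of_dense hD' (M := 2 * K * ‖x‖) (fun y y' => ?_) fun y hy => ?_
    · filter_upwards [hT] with i hi
      rw [← inner_sub_left, mul_comm]
      exact (norm_inner_le_norm _ _).trans (by gcongr; exact hb i x hi)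
    · simp only [inner_sub_right]
      exact tendsto_sub_nhds_zero_iff.2 (h x hx y hy)
  have h1 := tendsto_zero_of_dense hD (l := l) (φ := fun x i => inner ℂ y (T i x - L x))
    (M := ‖y‖ * (2 * K)) (fun x x' => ?_) (fun x hx => h0 x hx y) x
  · simp only [inner_sub_right] at h1
    exact tendsto_sub_nhds_zero_iff.1 h1
  · filter_upwards [hT] with i hi
    rw [← inner_sub_right]
    refine (norm_inner_le_norm _ _).trans ?_
    have h2 : T i x - L x - (T i x' - L x') = T i (x - x') - L (x - x') := by
      rw [map_sub, map_sub]; abel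
    rw [h2, mul_assoc]
    exact mul_le_mul_of_nonneg_left (hb i _ hi) (norm_nonneg _)

/-- A bounded family of operators whose matrix elements converge on dense sets converges
weakly. -/
theorem exists_weak_limit [CompleteSpace Y] {ι : Type*} {l : Filter ι} [l.NeBot]
    {T : ι → X →L[ℂ] Y} {K : ℝ} (hK : 0 ≤ K) (hT : ∀ᶠ i in l, ∀ x, ‖T i x‖ ≤ K * ‖x‖)
    {D : Set X} (hD : Dense D) {D' : Set Y} (hD' : Dense D')
    (h : ∀ x ∈ D, ∀ y ∈ D', ∃ c, Tendsto (fun i => inner ℂ y (T i x)) l (𝓝 c)) :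
    ∃ L : X →L[ℂ] Y, (∀ x, ‖L x‖ ≤ K * ‖x‖) ∧
      ∀ x y, Tendsto (fun i => inner ℂ y (T i x)) l (𝓝 (inner ℂ y (L x))) := by
  -- Along an ultrafilter every bounded matrix element converges, so the limiting form is defined on
  -- all vectors at once and its algebraic properties follow from uniqueness of limits.
  set U : Ultrafilter ι := Ultrafilter.of l
  have hU : (U : Filter ι) ≤ l := Ultrafilter.of_le l
  have hbd : ∀ x y, ∀ᶠ i in (U : Filter ι), ‖inner ℂ (T i x) y‖ ≤ K * ‖x‖ * ‖y‖ := by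
    intro x y
    filter_upwards [hU hT] with i hi
    exact (norm_inner_le_norm _ _).trans (by gcongr; exact hi x)
  have hex : ∀ x y, ∃ c, Tendsto (fun i => inner ℂ (T i x) y) (U : Filter ι) (𝓝 c) := by
    intro x y
    have hc := isCompact_closedBall (0 : ℂ) (K * ‖x‖ * ‖y‖)
    obtain ⟨c, -, hc'⟩ := hc.ultrafilter_le_nhds (U.map fun i => inner ℂ (T i x) y) (le_principal_iff.2
      ((hbd x y).mono fun i hi => mem_closedBall_zero_iff.2 hi))
    exact ⟨c, hc'⟩
  choose B hB using hex
  have hBle : ∀ x y, ‖B x y‖ ≤ K * ‖x‖ * ‖y‖ := fun x y => le_of_tendsto (hB x y).norm (hbd x y)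
  -- The form `B` is linear in `y` and conjugate linear in `x`. Riesz representation is again
  -- conjugate linear, so the operator `L` comes out linear.
  let ℓ : X → Y →L[ℂ] ℂ := fun x => LinearMap.mkContinuous
    { toFun := B x
      map_add' := fun y z => tendsto_nhds_unique (hB x (y + z))
        (((hB x y).add (hB x z)).congr fun i => (inner_add_right _ _ _).symm)
      map_smul' := fun c y => tendsto_nhds_unique (hB x (c • y))
        (((hB x y).const_mul c).congr fun i => (inner_smul_right _ _ _).symm) }
    (K * ‖x‖) (hBle x)
  let L₀ : X → Y := fun x => (InnerProductSpace.toDual ℂ Y).symm (ℓ x)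
  have hL₀ : ∀ x y, inner ℂ (L₀ x) y = B x y := fun x y =>
    InnerProductSpace.toDual_symm_apply
  let L : X →L[ℂ] Y := LinearMap.mkContinuous
    { toFun := L₀
      map_add' := fun x x' => by
        refine ext_inner_right ℂ fun y => ?_
        rw [inner_add_left, hL₀, hL₀, hL₀]
        refine tendsto_nhds_unique (hB (x + x') y) (((hB x y).add (hB x' y)).congr fun i => ?_)
        rw [map_add, inner_add_left]
      map_smul' := fun c x => by
        refine ext_inner_right ℂ fun y => ?_
        rw [RingHom.id_apply, inner_smul_left, hL₀, hL₀]
        refine tendsto_nhds_unique (hB (c • x) y)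
          (((hB x y).const_mul (conj c)).congr fun i => ?_)
        rw [map_smul, inner_smul_left] }
    K fun x => by
      change ‖(InnerProductSpace.toDual ℂ Y).symm (ℓ x)‖ ≤ _
      rw [LinearIsometryEquiv.norm_map]
      exact LinearMap.mkContinuous_norm_le _ (by positivity) _
  have hLn : ∀ x, ‖L x‖ ≤ K * ‖x‖ := fun x => by
    change ‖(InnerProductSpace.toDual ℂ Y).symm (ℓ x)‖ ≤ _
    rw [LinearIsometryEquiv.norm_map]
    exact LinearMap.mkContinuous_norm_le _ (by positivity) _
  refine ⟨L, hLn, tendsto_inner_of_dense hT hLn hD hD' fun x hx y hy => ?_⟩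
  obtain ⟨c, hc⟩ := h x hx y hy
  have h1 : Tendsto (fun i => inner ℂ y (T i x)) (U : Filter ι) (𝓝 (inner ℂ y (L x))) := by
    have h2 : inner ℂ y (L x) = conj (B x y) := by rw [← hL₀, inner_conj_symm]; rfl
    rw [h2]
    exact ((Complex.continuous_conj.tendsto _).comp (hB x y)).congr fun i => inner_conj_symm _ _
  -- On the dense sets the limit along `l` exists, so it must be the limit along the finer
  -- ultrafilter.
  rwa [tendsto_nhds_unique h1 (hc.mono_left hU)]

/-! ### Convolution with the transform of the surface measure -/

/-- The convolution of `f` with the Fourier transform of the surface measure. -/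
noncomputable def sphereConv (r : ℝ) (f : Euc n → ℂ) (x : Euc n) : ℂ :=
  ∫ y, sphereMeasureHat r (x - y) * f y

theorem norm_star_lp {α : Type*} [MeasurableSpace α] {μ : Measure α} {p : ℝ≥0∞} (f : Lp ℂ p μ) :
    ‖star f‖ = ‖f‖ := by
  rw [Lp.norm_def, Lp.norm_def, eLpNorm_congr_ae (Lp.coeFn_star f), eLpNorm_star]

theorem coeFn_star_ae (hV : AEMeasurable V volume) (f : L2InvWeight V) :
    (star f : L2InvWeight V) =ᵐ[volume] fun x => conj (f x) :=
  (absolutelyContinuous_invMeasure hV).ae_le (Lp.coeFn_star f)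

/-- Evaluation of the convolution at a point becomes a pairing with a fixed kernel; the star undoes
the conjugation in the second slot. -/
theorem sphereConv_eq_pairing_star (hV : AEMeasurable V volume) (r : ℝ) (f : L2InvWeight V)
    (x : Euc n) :
    sphereConv r f x = pairing (fun y => sphereMeasureHat r (x - y)) (star f : L2InvWeight V) := by
  refine integral_congr_ae ?_
  filter_upwards [coeFn_star_ae hV f] with y hy
  rw [hy, Complex.conj_conj]

section

variable {r B : ℝ}

/-- The restriction of the Fourier transform to the sphere of radius `r` is bounded on
`L²(|V|⁻¹)`, in the form of an estimate on test functions. -/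
def SphereRestrictionBound (V : Euc n → ℂ) (r B : ℝ) : Prop :=
  ∀ f g : L2InvWeight V, IsTestFunction f → IsTestFunction g →
    ‖∫ ξ, oscIntegral f ξ * conj (oscIntegral g ξ) ∂(sphereMeasure n r)‖ ≤ B * ‖f‖ * ‖g‖

/-- By duality: pairing the kernel with `g` evaluates the convolution of `conj g` at `x`, and
Cauchy–Schwarz on the sphere with the restriction bound controls its square by `S * B * ‖g‖²`. -/
theorem memLp_sphereMeasureHat_sub (hV : AEMeasurable V volume) (hB : 0 ≤ B)
    (h : SphereRestrictionBound V r B) (x : Euc n) :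
    MemLp (fun y => sphereMeasureHat r (x - y)) 2 (absMeasure V) := by
  have hm : AEStronglyMeasurable (fun y => sphereMeasureHat r (x - y)) volume :=
    ((continuous_sphereMeasureHat r).comp (by fun_prop)).aestronglyMeasurable
  refine ⟨hm.mono_ac absMeasure_absolutelyContinuous, ?_⟩
  set S := (sphereMeasure n r).real Set.univ
  have hS : 0 ≤ S := measureReal_nonneg
  refine (eLpNorm_le_of_norm_pairing_le hV hm (K := √(S * B)) (by positivity)
    fun g hg => ?_).trans_lt ENNReal.ofReal_lt_top
  have hg' : IsTestFunction (star g : L2InvWeight V) :=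
    hg.conj.congr_ae (coeFn_star_ae hV g).symm
  have h1 := sphereConv_eq_pairing_star hV r (star g) x
  rw [star_star] at h1
  have h2 := norm_integral_sphereMeasureHat_mul_sq_le r hg' x
  have h3 := h _ _ hg' hg'
  rw [← h1, sphereConv]
  refine abs_le_of_sq_le_sq' ?_ (by positivity) |>.2
  refine h2.trans ?_
  rw [mul_pow, Real.sq_sqrt (by positivity), mul_assoc]
  rw [norm_star_lp, mul_assoc, ← sq] at h3
  exact mul_le_mul_of_nonneg_left h3 hS

theorem integrable_sphereMeasureHat_mul (hV : AEMeasurable V volume) (hB : 0 ≤ B)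
    (h : SphereRestrictionBound V r B) (f : L2InvWeight V) (x : Euc n) :
    Integrable (fun y => sphereMeasureHat r (x - y) * f y) volume := by
  have hx := memLp_sphereMeasureHat_sub hV hB h x
  refine (integrable_mul_conj hV (hx.toLp _) (star f)).congr ?_
  refine (mul_ae_eq_of_ae_eq_absMeasure hV hx.coeFn_toLp _).trans ?_
  filter_upwards [coeFn_star_ae hV f] with y hy
  rw [hy, Complex.conj_conj]

theorem norm_sphereConv_le (hV : AEMeasurable V volume) (hB : 0 ≤ B)
    (h : SphereRestrictionBound V r B) (x : Euc n) (f : L2InvWeight V) :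
    ‖sphereConv r f x‖ ≤ ‖(memLp_sphereMeasureHat_sub hV hB h x).toLp _‖ * ‖f‖ := by
  rw [sphereConv_eq_pairing_star hV, ← pairing_congr_left hV
    (memLp_sphereMeasureHat_sub hV hB h x).coeFn_toLp, ← norm_star_lp f]
  exact norm_pairing_le hV _ _

theorem sphereConv_congr {f g : Euc n → ℂ} (hfg : f =ᵐ[volume] g) (x : Euc n) :
    sphereConv r f x = sphereConv r g x :=
  integral_congr_ae (hfg.mono fun y hy => by simp only [hy])

theorem sphereConv_add (hV : AEMeasurable V volume) (hB : 0 ≤ B)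
    (h : SphereRestrictionBound V r B) (f g : L2InvWeight V) (x : Euc n) :
    sphereConv r (f + g : L2InvWeight V) x = sphereConv r f x + sphereConv r g x := by
  rw [sphereConv_congr ((absolutelyContinuous_invMeasure hV).ae_le (Lp.coeFn_add f g)),
    sphereConv, sphereConv, sphereConv,
    ← integral_add (integrable_sphereMeasureHat_mul hV hB h f x)
      (integrable_sphereMeasureHat_mul hV hB h g x)]
  simp only [Pi.add_apply, mul_add]

theorem sphereConv_smul (hV : AEMeasurable V volume) (c : ℂ) (f : L2InvWeight V) (x : Euc n) :
    sphereConv r (c • f : L2InvWeight V) x = c * sphereConv r f x := by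
  rw [sphereConv_congr ((absolutelyContinuous_invMeasure hV).ae_le (Lp.coeFn_smul c f)),
    sphereConv, sphereConv, ← integral_const_mul]
  simp only [Pi.smul_apply, smul_eq_mul, mul_left_comm]

theorem stronglyMeasurable_sphereConv {μ : Measure (Euc n)} (f : Lp ℂ 2 μ) :
    StronglyMeasurable (sphereConv r f) := by
  refine StronglyMeasurable.integral_prod_right (f := fun x y => sphereMeasureHat r (x - y) * f y) ?_
  exact ((continuous_sphereMeasureHat r).comp (by fun_prop)).stronglyMeasurable.mul
    ((Lp.stronglyMeasurable f).comp_measurable measurable_snd)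

/-- For test functions this is duality with the restriction bound. In general, evaluation at each
point is continuous in `f`, so the convolutions of approximating test functions converge pointwise
and Fatou applies. -/
theorem eLpNorm_sphereConv_le (hV : AEMeasurable V volume) (hB : 0 ≤ B)
    (h : SphereRestrictionBound V r B) (f : L2InvWeight V) :
    eLpNorm (sphereConv r f) 2 (absMeasure V) ≤ ENNReal.ofReal (B * ‖f‖) := by
  have htest : ∀ f : L2InvWeight V, IsTestFunction f →
      eLpNorm (sphereConv r f) 2 (absMeasure V) ≤ ENNReal.ofReal (B * ‖f‖) := by
    intro f hf
    refine eLpNorm_le_of_norm_pairing_le hV (stronglyMeasurable_sphereConv f).aestronglyMeasurable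
      (by positivity) fun g hg => ?_
    have := pairing_integral_sphereMeasureHat_mul r hf hg
    rw [show sphereConv r f = fun x => ∫ y, sphereMeasureHat r (x - y) * f y from rfl, this]
    exact h f g hf hg
  obtain ⟨u, hu, hlim, -⟩ := exists_seq_isTestFunction hV f
  have hpt : ∀ x, Tendsto (fun k => sphereConv r (u k) x) atTop (𝓝 (sphereConv r f x)) := by
    intro x
    rw [← tendsto_sub_nhds_zero_iff]
    have h1 : Tendsto (fun k => ‖(memLp_sphereMeasureHat_sub hV hB h x).toLp _‖ * ‖u k - f‖) atTop
        (𝓝 0) := by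
      simpa using (tendsto_iff_norm_sub_tendsto_zero.1 hlim).const_mul
        ‖(memLp_sphereMeasureHat_sub hV hB h x).toLp _‖
    refine squeeze_zero_norm (fun k => ?_) h1
    have h2 : sphereConv r (u k) x - sphereConv r f x =
        sphereConv r (u k - f : L2InvWeight V) x := by
      rw [sub_eq_iff_eq_add, ← sphereConv_add hV hB h, sub_add_cancel]
    rw [h2]
    exact norm_sphereConv_le hV hB h x _
  refine (Lp.eLpNorm_lim_le_liminf_eLpNorm
    (fun k => (stronglyMeasurable_sphereConv (u k)).aestronglyMeasurable) _
    (ae_of_all _ hpt)).trans ?_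
  refine (liminf_le_liminf (Eventually.of_forall fun k => htest _ (hu k))).trans_eq ?_
  exact (ENNReal.tendsto_ofReal (hlim.norm.const_mul B)).liminf_eq

theorem memLp_sphereConv (hV : AEMeasurable V volume) (hB : 0 ≤ B)
    (h : SphereRestrictionBound V r B) (f : L2InvWeight V) :
    MemLp (sphereConv r f) 2 (absMeasure V) :=
  ⟨(stronglyMeasurable_sphereConv f).aestronglyMeasurable,
    (eLpNorm_sphereConv_le hV hB h f).trans_lt ENNReal.ofReal_lt_top⟩

/-- Convolution with the transform of the surface measure as a bounded operator. -/
noncomputable def sphereConvCLM (hV : AEMeasurable V volume) (hB : 0 ≤ B)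
    (h : SphereRestrictionBound V r B) : L2InvWeight V →L[ℂ] L2Weight V :=
  LinearMap.mkContinuous
    { toFun := fun f => (memLp_sphereConv hV hB h f).toLp _
      map_add' := fun f g => by
        rw [← MemLp.toLp_add]
        exact MemLp.toLp_congr _ _ (ae_of_all _ (sphereConv_add hV hB h f g))
      map_smul' := fun c f => by
        rw [RingHom.id_apply, ← MemLp.toLp_const_smul]
        exact MemLp.toLp_congr _ _ (ae_of_all _ (sphereConv_smul hV c f)) }
    B fun f => norm_lp_le_of_eLpNorm_le (memLp_sphereConv hV hB h f) (by positivity) (eLpNorm_sphereConv_le hV hB h f)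

theorem coeFn_sphereConvCLM (hV : AEMeasurable V volume) (hB : 0 ≤ B)
    (h : SphereRestrictionBound V r B) (f : L2InvWeight V) :
    sphereConvCLM hV hB h f =ᵐ[absMeasure V] sphereConv r f :=
  (memLp_sphereConv hV hB h f).coeFn_toLp

theorem pairing_sphereConvCLM (hV : AEMeasurable V volume) (hB : 0 ≤ B)
    (h : SphereRestrictionBound V r B) {f g : L2InvWeight V} (hf : IsTestFunction f)
    (hg : IsTestFunction g) :
    pairing (sphereConvCLM hV hB h f) g =
      ∫ ξ, oscIntegral f ξ * conj (oscIntegral g ξ) ∂(sphereMeasure n r) := by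
  rw [pairing_congr_left hV (coeFn_sphereConvCLM hV hB h f)]
  exact pairing_integral_sphereMeasureHat_mul r hf hg

end

/-! ### The resolvent and the truncated singular integrals -/

theorem norm_resolventSymbol_le {z : ℂ} (hz : z.im ≠ 0) (t : ℝ) :
    ‖1 / ((t : ℂ) - z)‖ ≤ |z.im|⁻¹ := by
  rw [norm_div, norm_one, one_div]
  refine inv_anti₀ (abs_pos.2 hz) ?_
  refine le_trans (le_of_eq ?_) (Complex.abs_im_le_norm _)
  rw [Complex.sub_im, Complex.ofReal_im, zero_sub, abs_neg]

theorem measurable_resolventSymbol (z : ℂ) : Measurable fun t : ℝ => 1 / ((t : ℂ) - z) := by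
  fun_prop

theorem exists_clm_eq_freeResolvent {z : ℂ} (hz : z.im ≠ 0) :
    ∃ A : L2 n →L[ℂ] L2 n, ⇑A = freeResolvent z := by
  obtain ⟨A, hA⟩ := exists_clm_eq_fourierMultiplierL2 (n := n)
    (m := fun ξ => 1 / (((‖ξ‖ ^ 2 : ℝ) : ℂ) - z))
    ((measurable_resolventSymbol z).comp (by fun_prop)) (fun ξ => norm_resolventSymbol_le hz _)
  exact ⟨A, funext hA⟩

theorem truncatedSingular_eq (lam δ : ℝ) : (truncatedSingular lam δ : L2 n → L2 n) =
    fourierMultiplierL2 (fun ξ => (truncatedInv δ (‖ξ‖ ^ 2 - lam) : ℂ)) := by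
  unfold truncatedSingular truncatedInv
  congr 1
  ext ξ
  split_ifs <;> simp

theorem exists_clm_eq_truncatedSingular (lam : ℝ) {δ : ℝ} (hδ : 0 < δ) :
    ∃ A : L2 n →L[ℂ] L2 n, ⇑A = truncatedSingular lam δ := by
  obtain ⟨A, hA⟩ := exists_clm_eq_fourierMultiplierL2 (n := n) (M := δ⁻¹)
    (m := fun ξ => (truncatedInv δ (‖ξ‖ ^ 2 - lam) : ℂ))
    (Complex.measurable_ofReal.comp ((measurable_truncatedInv δ).comp (by fun_prop)))
    (fun ξ => by simpa using abs_truncatedInv_le hδ _)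
  exact ⟨A, by rw [truncatedSingular_eq]; exact funext hA⟩

variable {f g : Euc n → ℂ}

theorem pairing_freeResolvent (hn : 2 ≤ n) {z : ℂ} (hz : z.im ≠ 0) (hf : IsTestFunction f)
    (hg : IsTestFunction g) : pairing (freeResolvent z (hf.memLp.toLp f)) g =
      ∫ t : ℝ, 1 / ((t : ℂ) - z) * spectralDensity f g t :=
  pairing_fourierMultiplierL2_eq_integral hn (measurable_resolventSymbol z)
    (norm_resolventSymbol_le hz) hf hg

theorem pairing_truncatedSingular (hn : 2 ≤ n) (lam : ℝ) {δ : ℝ} (hδ : 0 < δ)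
    (hf : IsTestFunction f) (hg : IsTestFunction g) :
    pairing (truncatedSingular lam δ (hf.memLp.toLp f)) g =
      ∫ t : ℝ, (truncatedInv δ (t - lam) : ℂ) * spectralDensity f g t := by
  rw [truncatedSingular_eq]
  exact pairing_fourierMultiplierL2_eq_integral (m := fun t => (truncatedInv δ (t - lam) : ℂ)) hn
    (Complex.measurable_ofReal.comp ((measurable_truncatedInv δ).comp (by fun_prop))) (M := δ⁻¹)
    (fun t => by simpa using abs_truncatedInv_le hδ _) hf hg

theorem integrable_ofReal_mul {G : ℝ → ℂ} (hG : Integrable G) {k : ℝ → ℝ} (hk : Measurable k)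
    {M : ℝ} (hM : ∀ t, |k t| ≤ M) : Integrable fun t => (k t : ℂ) * G t :=
  hG.bdd_mul (c := M) (Complex.measurable_ofReal.comp hk).aestronglyMeasurable
    (ae_of_all _ fun t => by simpa using hM t)

theorem abs_poissonKernel_le {ε : ℝ} (hε : 0 < ε) (t : ℝ) : |ε / (t ^ 2 + ε ^ 2)| ≤ ε⁻¹ := by
  rw [abs_of_nonneg (by positivity), div_le_iff₀ (by positivity)]
  field_simp
  nlinarith [sq_nonneg t]

theorem abs_conjPoissonKernel_le {ε : ℝ} (hε : 0 < ε) (t : ℝ) :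
    |t / (t ^ 2 + ε ^ 2)| ≤ ε⁻¹ := by
  rw [abs_div, abs_of_pos (by positivity : 0 < t ^ 2 + ε ^ 2), div_le_iff₀ (by positivity)]
  rw [← sq_abs t]
  field_simp
  nlinarith [sq_nonneg (|t| - ε), abs_nonneg t]

/-- Real part and imaginary part: the sign `s` affects only the Poisson kernel, so sums and
differences over `s` separate the two. -/
theorem resolventSymbol_eq {lam ε s : ℝ} (hε : 0 < ε) (hs : s = 1 ∨ s = -1) (t : ℝ) :
    1 / ((t : ℂ) - (lam + s * ε * Complex.I)) =
      (((t - lam) / ((t - lam) ^ 2 + ε ^ 2) : ℝ) : ℂ) +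
        s * Complex.I * ((ε / ((t - lam) ^ 2 + ε ^ 2) : ℝ) : ℂ) := by
  have hs2 : (s : ℂ) ^ 2 = 1 := by rcases hs with rfl | rfl <;> simp
  have hp : (((t - lam) ^ 2 + ε ^ 2 : ℝ) : ℂ) ≠ 0 := by
    rw [Complex.ofReal_ne_zero]; positivity
  have him : ((lam : ℂ) + s * ε * Complex.I).im ≠ 0 := by
    rcases hs with rfl | rfl <;> simp [hε.ne']
  have hne := symbol_ne_zero him t
  rw [Complex.ofReal_div, Complex.ofReal_div, ← mul_div_assoc, ← add_div, div_eq_div_iff hne hp]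
  push_cast
  have hI := Complex.I_sq
  linear_combination (-(ε : ℂ) ^ 2) * hs2 + ((s : ℂ) ^ 2 * ε ^ 2) * hI

theorem im_ne_zero {lam ε s : ℝ} (hε : 0 < ε) (hs : s = 1 ∨ s = -1) :
    ((lam : ℂ) + s * ε * Complex.I).im ≠ 0 := by
  rcases hs with rfl | rfl <;> simp [hε.ne']

theorem pairing_freeResolvent_eq_add (hn : 2 ≤ n) {lam ε s : ℝ} (hε : 0 < ε)
    (hs : s = 1 ∨ s = -1) (hf : IsTestFunction f) (hg : IsTestFunction g) :
    pairing (freeResolvent (lam + s * ε * Complex.I) (hf.memLp.toLp f)) g =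
      (∫ t, (((t - lam) / ((t - lam) ^ 2 + ε ^ 2) : ℝ) : ℂ) * spectralDensity f g t) +
        s * Complex.I * ∫ t, ((ε / ((t - lam) ^ 2 + ε ^ 2) : ℝ) : ℂ) * spectralDensity f g t := by
  have hG := integrable_spectralDensity hn hf hg
  rw [pairing_freeResolvent hn (im_ne_zero hε hs) hf hg, ← integral_const_mul, ← integral_add]
  · refine integral_congr_ae (ae_of_all _ fun t => ?_)
    simp only
    rw [resolventSymbol_eq hε hs]
    ring
  · exact integrable_ofReal_mul hG (by fun_prop) fun t => abs_conjPoissonKernel_le hε _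
  · exact (integrable_ofReal_mul hG (by fun_prop) fun t => abs_poissonKernel_le hε _).const_mul _

theorem pairing_truncatedSingular_eq_add (hn : 2 ≤ n) (lam : ℝ) {δ : ℝ} (hδ : 0 < δ)
    (hf : IsTestFunction f) (hg : IsTestFunction g) :
    pairing (truncatedSingular lam δ (hf.memLp.toLp f)) g =
      (∫ t, (((t - lam) / ((t - lam) ^ 2 + δ ^ 2) : ℝ) : ℂ) * spectralDensity f g t) +
        ∫ t, ((δ⁻¹ * oddKernel ((t - lam) / δ) : ℝ) : ℂ) * spectralDensity f g t := by
  have hG := integrable_spectralDensity hn hf hg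
  rw [pairing_truncatedSingular hn lam hδ hf hg, ← integral_add]
  · refine integral_congr_ae (ae_of_all _ fun t => ?_)
    simp only
    rw [truncatedInv_eq hδ, Complex.ofReal_add, add_mul]
  · exact integrable_ofReal_mul hG (by fun_prop) fun t => abs_conjPoissonKernel_le hδ _
  · refine integrable_ofReal_mul hG
      ((measurable_oddKernel.comp (by fun_prop)).const_mul _) (M := δ⁻¹ * 1) fun t => ?_
    rw [abs_mul, abs_of_pos (inv_pos.2 hδ)]
    refine mul_le_mul_of_nonneg_left ((abs_oddKernel_le _).trans ?_) (by positivity)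
    exact inv_le_one_of_one_le₀ (by nlinarith [sq_nonneg ((t - lam) / δ)])

/-! ### Consequences of the resolvent estimate -/

/-- The weighted resolvent estimate, uniform in `z ∈ ℂ ∖ ℝ`. -/
def ResolventEstimate (V : Euc n → ℂ) (C : ℝ≥0) : Prop :=
  ∀ z : ℂ, z.im ≠ 0 → ∀ f : L2 n, MemLp f 2 (weightMeasure (fun x => ‖V x‖ₑ⁻¹)) →
    eLpNorm (freeResolvent z f) 2 (weightMeasure (fun x => ‖V x‖ₑ)) ≤
      C * eLpNorm f 2 (weightMeasure (fun x => ‖V x‖ₑ⁻¹))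

variable {C : ℝ≥0}

theorem ResolventEstimate.eLpNorm_le (hres : ResolventEstimate V C) {z : ℂ} (hz : z.im ≠ 0)
    (f : L2InvWeight V) (hf : MemLp f 2 volume) :
    eLpNorm (freeResolvent z (hf.toLp f)) 2 (absMeasure V) ≤ ENNReal.ofReal (C * ‖f‖) := by
  have h1 : (hf.toLp f : L2 n) =ᵐ[invMeasure V] f :=
    invMeasure_absolutelyContinuous.ae_le hf.coeFn_toLp
  refine (hres z hz _ ((Lp.memLp f).ae_eq h1.symm)).trans_eq ?_
  rw [eLpNorm_congr_ae h1, ENNReal.ofReal_mul C.coe_nonneg, Lp.norm_def,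
    ENNReal.ofReal_toReal (Lp.eLpNorm_ne_top f)]
  simp

theorem ResolventEstimate.exists_extension (hres : ResolventEstimate V C)
    (hV : AEMeasurable V volume) {z : ℂ} (hz : z.im ≠ 0) :
    ∃ T, IsWeightedExtension V (freeResolvent z) T ∧ (∀ f, ‖T f‖ ≤ C * ‖f‖) ∧
      ∀ T', IsWeightedExtension V (freeResolvent z) T' → T' = T := by
  obtain ⟨A, hA⟩ := exists_clm_eq_freeResolvent (n := n) hz
  rw [← hA]
  refine exists_isWeightedExtension hV A C.2 fun f hf => ?_
  rw [hA]
  exact hres.eLpNorm_le hz f hf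

theorem pairing_weightedExtension (hV : AEMeasurable V volume) {A : L2 n → L2 n}
    {T : L2InvWeight V →L[ℂ] L2Weight V} (h : IsWeightedExtension V A T) {f : L2InvWeight V}
    (hf : IsTestFunction f) (g : L2InvWeight V) :
    pairing (T f) g = pairing (A (hf.memLp.toLp f)) g :=
  pairing_congr_left hV (h f hf.memLp) g

theorem ResolventEstimate.norm_pairing_le (hres : ResolventEstimate V C)
    (hV : AEMeasurable V volume) {z : ℂ} (hz : z.im ≠ 0) {f : L2InvWeight V}
    (hf : IsTestFunction f) (g : L2InvWeight V) :
    ‖pairing (freeResolvent z (hf.memLp.toLp f)) g‖ ≤ C * ‖f‖ * ‖g‖ := by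
  obtain ⟨T, hT, hTn, -⟩ := hres.exists_extension hV hz
  rw [← pairing_weightedExtension hV hT hf]
  exact (_root_.norm_pairing_le hV _ _).trans (by gcongr; exact hTn f)

/-- The spectral density is bounded in the weighted norms. -/
theorem ResolventEstimate.norm_spectralDensity_le (hres : ResolventEstimate V C)
    (hV : AEMeasurable V volume) (hn : 2 ≤ n) {f g : L2InvWeight V} (hf : IsTestFunction f)
    (hg : IsTestFunction g) (a : ℝ) :
    Real.pi * ‖spectralDensity f g a‖ ≤ C * ‖f‖ * ‖g‖ := by
  by_cases ha : 0 < a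
  · have h1 := (tendsto_integral_poissonKernel (integrable_spectralDensity hn hf hg)
      (continuousAt_spectralDensity hf hg ha)).norm
    rw [norm_mul, Complex.norm_real, Real.norm_of_nonneg Real.pi_pos.le] at h1
    refine le_of_tendsto h1 ?_
    filter_upwards [self_mem_nhdsWithin] with ε (hε : 0 < ε)
    have hp := pairing_freeResolvent_eq_add hn (lam := a) (s := 1) hε (Or.inl rfl) hf hg
    have hm := pairing_freeResolvent_eq_add hn (lam := a) (s := -1) hε (Or.inr rfl) hf hg
    have hpn := hres.norm_pairing_le hV (im_ne_zero (lam := a) (s := 1) hε (Or.inl rfl)) hf g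
    have hmn := hres.norm_pairing_le hV (im_ne_zero (lam := a) (s := -1) hε (Or.inr rfl)) hf g
    rw [hp] at hpn
    rw [hm] at hmn
    set c := ∫ t, (((t - a) / ((t - a) ^ 2 + ε ^ 2) : ℝ) : ℂ) * spectralDensity f g t
    set p := ∫ t, ((ε / ((t - a) ^ 2 + ε ^ 2) : ℝ) : ℂ) * spectralDensity f g t
    -- The jump of the resolvent across the axis is `2 i p`. Each of the two resolvents costs `C`,
    -- so `p` itself is bounded with constant `C`.
    have h2 : 2 * ‖p‖ = ‖(c + ((1 : ℝ) : ℂ) * Complex.I * p) -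
        (c + ((-1 : ℝ) : ℂ) * Complex.I * p)‖ := by
      have : (c + ((1 : ℝ) : ℂ) * Complex.I * p) - (c + ((-1 : ℝ) : ℂ) * Complex.I * p) =
          2 * Complex.I * p := by push_cast; ring
      rw [this]
      simp
    linarith [norm_sub_le (c + ((1 : ℝ) : ℂ) * Complex.I * p)
      (c + ((-1 : ℝ) : ℂ) * Complex.I * p)]
  · rw [spectralDensity, if_neg ha, norm_zero, mul_zero]
    positivity

theorem integral_sphereMeasure_eq_spectralDensity (f g : Euc n → ℂ) {lam : ℝ} (hlam : 0 < lam) :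
    ∫ ξ, oscIntegral f ξ * conj (oscIntegral g ξ) ∂(sphereMeasure n (√lam)) =
      (2 * Real.pi : ℂ) ^ n * (2 * √lam) * spectralDensity f g lam := by
  have h1 : (√lam : ℂ) ≠ 0 := by simpa using (Real.sqrt_pos.2 hlam).ne'
  have h2 : (2 * Real.pi : ℂ) ≠ 0 := by simp [Real.pi_ne_zero]
  rw [spectralDensity, if_pos hlam]
  push_cast
  field_simp

/-- The integral over the sphere is `(2π)ⁿ 2√lam` times the spectral density at `lam`, which is
bounded with constant `C / π`. -/
theorem ResolventEstimate.exists_sphereRestrictionBound (hres : ResolventEstimate V C)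
    (hV : AEMeasurable V volume) (hn : 2 ≤ n) {lam : ℝ} (hlam : 0 < lam) :
    ∃ B : ℝ, 0 ≤ B ∧ SphereRestrictionBound V (√lam) B := by
  refine ⟨(2 * Real.pi) ^ n * (2 * √lam) * (C / Real.pi), by positivity, fun f g hf hg => ?_⟩
  have h := hres.norm_spectralDensity_le hV hn hf hg lam
  rw [mul_comm, ← le_div_iff₀ Real.pi_pos] at h
  rw [integral_sphereMeasure_eq_spectralDensity _ _ hlam, norm_mul]
  have h1 : ‖(2 * Real.pi : ℂ) ^ n * (2 * √lam)‖ = (2 * Real.pi) ^ n * (2 * √lam) := by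
    rw [norm_mul, norm_pow, norm_mul, norm_mul, Complex.norm_real, Complex.norm_real,
      Real.norm_of_nonneg Real.pi_pos.le, Real.norm_of_nonneg (Real.sqrt_nonneg _)]
    simp
  rw [h1]
  calc _ ≤ (2 * Real.pi) ^ n * (2 * √lam) * (C * ‖f‖ * ‖g‖ / Real.pi) := by gcongr
    _ = _ := by ring

/-- One `C` bounds the conjugate Poisson part, half the sum of the two resolvents. The other bounds
the odd part: its kernel has `L¹` norm at most `π`, and the density is at most `C / π` times the
norms. -/
theorem ResolventEstimate.norm_pairing_truncatedSingular_le (hres : ResolventEstimate V C)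
    (hV : AEMeasurable V volume) (hn : 2 ≤ n) (lam : ℝ) {δ : ℝ} (hδ : 0 < δ) {f g : L2InvWeight V}
    (hf : IsTestFunction f) (hg : IsTestFunction g) :
    ‖pairing (truncatedSingular lam δ (hf.memLp.toLp f)) g‖ ≤ 2 * C * ‖f‖ * ‖g‖ := by
  have hp := pairing_freeResolvent_eq_add hn (lam := lam) (s := 1) hδ (Or.inl rfl) hf hg
  have hm := pairing_freeResolvent_eq_add hn (lam := lam) (s := -1) hδ (Or.inr rfl) hf hg
  have hpn := hres.norm_pairing_le hV (im_ne_zero (lam := lam) (s := 1) hδ (Or.inl rfl)) hf g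
  have hmn := hres.norm_pairing_le hV (im_ne_zero (lam := lam) (s := -1) hδ (Or.inr rfl)) hf g
  have ho := norm_integral_dilated_oddKernel_mul_le (G := spectralDensity f g)
    (M := C * ‖f‖ * ‖g‖ / Real.pi) (fun t => by
      rw [le_div_iff₀ Real.pi_pos, mul_comm]
      exact hres.norm_spectralDensity_le hV hn hf hg t) lam hδ
  rw [mul_div_cancel₀ _ Real.pi_ne_zero] at ho
  rw [pairing_truncatedSingular_eq_add hn lam hδ hf hg]
  rw [hp] at hpn
  rw [hm] at hmn
  set c := ∫ t, (((t - lam) / ((t - lam) ^ 2 + δ ^ 2) : ℝ) : ℂ) * spectralDensity f g t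
  set p := ∫ t, ((δ / ((t - lam) ^ 2 + δ ^ 2) : ℝ) : ℂ) * spectralDensity f g t
  set o := ∫ t, ((δ⁻¹ * oddKernel ((t - lam) / δ) : ℝ) : ℂ) * spectralDensity f g t
  have h2 : 2 * ‖c‖ = ‖(c + ((1 : ℝ) : ℂ) * Complex.I * p) +
      (c + ((-1 : ℝ) : ℂ) * Complex.I * p)‖ := by
    have : (c + ((1 : ℝ) : ℂ) * Complex.I * p) + (c + ((-1 : ℝ) : ℂ) * Complex.I * p) =
        2 * c := by push_cast; ring
    rw [this]
    simp
  have h3 := norm_add_le (c + ((1 : ℝ) : ℂ) * Complex.I * p) (c + ((-1 : ℝ) : ℂ) * Complex.I * p)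
  linarith [norm_add_le c o]

theorem ResolventEstimate.exists_extension_truncatedSingular (hres : ResolventEstimate V C)
    (hV : AEMeasurable V volume) (hn : 2 ≤ n) (lam : ℝ) {δ : ℝ} (hδ : 0 < δ) :
    ∃ T, IsWeightedExtension V (truncatedSingular lam δ) T ∧ (∀ f, ‖T f‖ ≤ 2 * C * ‖f‖) ∧
      ∀ T', IsWeightedExtension V (truncatedSingular lam δ) T' → T' = T := by
  obtain ⟨A, hA⟩ := exists_clm_eq_truncatedSingular (n := n) lam hδ
  rw [← hA]
  refine exists_isWeightedExtension hV A (by positivity) fun f hf => ?_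
  refine eLpNorm_le_of_norm_pairing_testFunction_le hV A (by positivity)
    (fun f g hf hg => ?_) f hf
  rw [hA]
  exact hres.norm_pairing_truncatedSingular_le hV hn lam hδ hf hg

/-- The limits of the matrix elements of the truncated integrals and of the resolvents. -/
theorem ResolventEstimate.exists_tendsto_pairing (hres : ResolventEstimate V C)
    (hV : AEMeasurable V volume) (hn : 2 ≤ n) {lam : ℝ} (hlam : 0 < lam) {s : ℝ}
    (hs : s = 1 ∨ s = -1) {f g : L2InvWeight V} (hf : IsTestFunction f) (hg : IsTestFunction g) :
    ∃ l, Tendsto (fun δ => pairing (truncatedSingular lam δ (hf.memLp.toLp f)) g) (𝓝[>] 0) (𝓝 l) ∧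
      Tendsto (fun ε : ℝ =>
        pairing (freeResolvent (lam + s * ε * Complex.I) (hf.memLp.toLp f)) g) (𝓝[>] 0)
        (𝓝 (s * Complex.I * (Real.pi * spectralDensity f g lam) + l)) := by
  have hG := integrable_spectralDensity hn hf hg
  have hGc := continuousAt_spectralDensity hf hg hlam
  obtain ⟨l, hl⟩ := exists_tendsto_integral_truncatedInv hG (isBigO_spectralDensity hf hg hlam)
  have hP : Tendsto (fun δ => pairing (truncatedSingular lam δ (hf.memLp.toLp f)) g) (𝓝[>] 0)
      (𝓝 l) := by
    refine hl.congr' ?_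
    filter_upwards [self_mem_nhdsWithin] with δ (hδ : 0 < δ)
    rw [pairing_truncatedSingular hn lam hδ hf hg]
  refine ⟨l, hP, ?_⟩
  have ho := tendsto_integral_dilated_oddKernel_mul hG.1 (M := C * ‖f‖ * ‖g‖ / Real.pi)
    (fun t => by
      rw [le_div_iff₀ Real.pi_pos, mul_comm]
      exact hres.norm_spectralDensity_le hV hn hf hg t) hGc
  have hp := (tendsto_integral_poissonKernel hG hGc).const_mul ((s : ℂ) * Complex.I)
  -- With `δ = ε`, the conjugate Poisson integral is the truncated integral minus the odd error,
  -- which tends to zero.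
  have h := hp.add (hP.sub ho)
  rw [sub_zero] at h
  refine h.congr' ?_
  filter_upwards [self_mem_nhdsWithin] with ε (hε : 0 < ε)
  rw [pairing_freeResolvent_eq_add hn hε hs hf hg, pairing_truncatedSingular_eq_add hn lam hε hf hg]
  ring

theorem exists_weak_limit_pairing (hV : AEMeasurable V volume) {l : Filter ℝ} [l.NeBot]
    {T : ℝ → L2InvWeight V →L[ℂ] L2Weight V} {K : ℝ} (hK : 0 ≤ K)
    (hT : ∀ᶠ i in l, ∀ f, ‖T i f‖ ≤ K * ‖f‖)
    (h : ∀ f g : L2InvWeight V, IsTestFunction f → IsTestFunction g →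
      ∃ c, Tendsto (fun i => pairing (T i f) g) l (𝓝 c)) :
    ∃ L : L2InvWeight V →L[ℂ] L2Weight V, (∀ f, ‖L f‖ ≤ K * ‖f‖) ∧
      ∀ f g : L2InvWeight V, Tendsto (fun i => pairing (T i f) g) l (𝓝 (pairing (L f) g)) := by
  have hD' : Dense ((normMulEquiv hV).symm '' {f : L2InvWeight V | IsTestFunction f}) :=
    (normMulEquiv hV).symm.surjective.denseRange.dense_image
      (normMulEquiv hV).symm.continuous (dense_isTestFunction hV)
  obtain ⟨L, hL, hlim⟩ := exists_weak_limit hK hT (dense_isTestFunction hV) hD' (by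
    rintro f hf _ ⟨g, hg, rfl⟩
    obtain ⟨c, hc⟩ := h f g hf hg
    exact ⟨c, hc.congr fun i => pairing_eq_inner hV _ _⟩)
  refine ⟨L, hL, fun f g => ?_⟩
  simp only [pairing_eq_inner hV]
  exact hlim f _

/-- Operators are determined by their matrix elements between test functions. -/
theorem clm_eq_of_pairing_eq (hV : AEMeasurable V volume)
    {S T : L2InvWeight V →L[ℂ] L2Weight V}
    (h : ∀ f g : L2InvWeight V, IsTestFunction f → IsTestFunction g →
      pairing (S f) g = pairing (T f) g) : S = T := by
  have h1 : ∀ f : L2InvWeight V, IsTestFunction f → S f = T f := by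
    intro f hf
    refine ext_inner_left ℂ fun v => ?_
    have h2 : ∀ g : L2InvWeight V, inner ℂ ((normMulEquiv hV).symm g) (S f) =
        inner ℂ ((normMulEquiv hV).symm g) (T f) := by
      have hc : ∀ w : L2Weight V, Continuous fun g : L2InvWeight V =>
          inner ℂ ((normMulEquiv hV).symm g) w := fun w =>
        (normMulEquiv hV).symm.continuous.inner continuous_const
      exact fun g => congrFun (Continuous.ext_on (dense_isTestFunction hV) (hc _) (hc _)
        fun g hg => by rw [← pairing_eq_inner, ← pairing_eq_inner]; exact h f g hf hg) g
    simpa using h2 (normMulEquiv hV v)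
  exact ContinuousLinearMap.ext fun f => congrFun (Continuous.ext_on (dense_isTestFunction hV)
    S.continuous T.continuous h1) f

end WeightedSpaces

/-! ### The limiting absorption principle -/

theorem mainTheorem10 (n : ℕ) (hn : 2 ≤ n) (V : EuclideanSpace ℝ (Fin n) → ℂ)
    (hV : AEMeasurable V volume) (C : ℝ≥0)
    -- the resolvent estimate, uniform in `z ∈ ℂ ∖ ℝ`
    (hres : ∀ z : ℂ, z.im ≠ 0 → ∀ f : L2 n, MemLp f 2 (weightMeasure (fun x => ‖V x‖ₑ⁻¹)) →
      eLpNorm (freeResolvent z f) 2 (weightMeasure (fun x => ‖V x‖ₑ)) ≤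
        C * eLpNorm f 2 (weightMeasure (fun x => ‖V x‖ₑ⁻¹))) :
    -- `R₀(z)` and the truncated singular integrals extend uniquely from `L² ∩ L²(|V|⁻¹)`
    -- to bounded operators from `L²(|V|⁻¹)` to `L²(|V|)`
    (∀ z : ℂ, z.im ≠ 0 → ∃! T, IsWeightedExtension V (freeResolvent z) T) ∧
    (∀ lam δ : ℝ, 0 < lam → 0 < δ → ∃! T, IsWeightedExtension V (truncatedSingular lam δ) T) ∧
    -- `L` is `R₀(lam ± i0)`, the sign being that of `s`
    ∀ lam : ℝ, 0 < lam → ∀ s : ℝ, s = 1 ∨ s = -1 →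
      ∃ L : L2InvWeight V →L[ℂ] L2Weight V,
        (∀ f g : L2InvWeight V,
          Tendsto (fun ε : ℝ =>
              pairing (weightedExtension V (freeResolvent (lam + s * ε * Complex.I)) f) g)
            (𝓝[>] 0) (𝓝 (pairing (L f) g))) ∧
        (∀ f : L2InvWeight V, ‖L f‖ ≤ C * ‖f‖) ∧
        ∀ f : L2InvWeight V,
          -- the convolution of the transform of `dσ_√lam` with `f` converges absolutely
          -- and lies in `L²(|V|)`
          (∀ x, Integrable (fun y => sphereMeasureHat (√lam) (x - y) * f y) volume) ∧
          MemLp (fun x => ∫ y, sphereMeasureHat (√lam) (x - y) * f y) 2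
            (weightMeasure (fun x => ‖V x‖ₑ)) ∧
          -- `w` is the principal value integral, a weak limit of the truncated integrals
          ∃ w : L2Weight V,
            (∀ g : L2InvWeight V,
              Tendsto (fun δ : ℝ =>
                  pairing (weightedExtension V (truncatedSingular lam δ) f) g)
                (𝓝[>] 0) (𝓝 (pairing w g))) ∧
            L f =ᵐ[weightMeasure (fun x => ‖V x‖ₑ)] fun x =>
              s * ((2 * Real.pi : ℂ) ^ n)⁻¹ * (Complex.I * Real.pi / (2 * √lam)) *
                (∫ y, sphereMeasureHat (√lam) (x - y) * f y) + w x := by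

  have hres' : ResolventEstimate V C := hres
  have hRext := fun (z : ℂ) (hz : z.im ≠ 0) => hres'.exists_extension hV hz
  have hPext := fun (lam δ : ℝ) (hδ : 0 < δ) =>
    hres'.exists_extension_truncatedSingular hV hn lam hδ
  refine ⟨fun z hz => ?_, fun lam δ _ hδ => ?_, fun lam hlam s hs => ?_⟩
  · obtain ⟨T, hT, -, hu⟩ := hRext z hz
    exact ⟨T, hT, hu⟩
  · obtain ⟨T, hT, -, hu⟩ := hPext lam δ hδ
    exact ⟨T, hT, hu⟩
  have hR : ∀ ε : ℝ, 0 < ε →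
      IsWeightedExtension V (freeResolvent (lam + s * ε * Complex.I))
        (weightedExtension V (freeResolvent (lam + s * ε * Complex.I))) ∧
      ∀ f, ‖weightedExtension V (freeResolvent (lam + s * ε * Complex.I)) f‖ ≤ C * ‖f‖ := by
    intro ε hε
    obtain ⟨T, hT, hTn, hu⟩ := hRext _ (im_ne_zero (lam := lam) hε hs)
    -- The chosen extension carries no bound by itself; uniqueness identifies it with the bounded
    -- one.
    have h := weightedExtension_spec ⟨T, hT⟩
    exact ⟨h, by rwa [hu _ h]⟩
  have hP : ∀ δ : ℝ, 0 < δ →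
      IsWeightedExtension V (truncatedSingular lam δ)
        (weightedExtension V (truncatedSingular lam δ)) ∧
      ∀ f, ‖weightedExtension V (truncatedSingular lam δ) f‖ ≤ 2 * C * ‖f‖ := by
    intro δ hδ
    obtain ⟨T, hT, hTn, hu⟩ := hPext lam δ hδ
    have h := weightedExtension_spec ⟨T, hT⟩
    exact ⟨h, by rwa [hu _ h]⟩
  have hlimits : ∀ f g : L2InvWeight V, IsTestFunction f → IsTestFunction g →
      ∃ l, Tendsto (fun δ => pairing (weightedExtension V (truncatedSingular lam δ) f) g)
        (𝓝[>] 0) (𝓝 l) ∧ Tendsto (fun ε : ℝ =>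
          pairing (weightedExtension V (freeResolvent (lam + s * ε * Complex.I)) f) g) (𝓝[>] 0)
          (𝓝 (s * Complex.I * (Real.pi * spectralDensity f g lam) + l)) := by
    intro f g hf hg
    obtain ⟨l, h1, h2⟩ := hres'.exists_tendsto_pairing hV hn hlam hs hf hg
    refine ⟨l, h1.congr' ?_, h2.congr' ?_⟩
    · filter_upwards [self_mem_nhdsWithin] with δ hδ
      rw [pairing_weightedExtension hV (hP δ hδ).1 hf]
    · filter_upwards [self_mem_nhdsWithin] with ε hε
      rw [pairing_weightedExtension hV (hR ε hε).1 hf]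
  obtain ⟨W, -, hW⟩ := exists_weak_limit_pairing hV (l := 𝓝[>] (0 : ℝ))
    (T := fun δ => weightedExtension V (truncatedSingular lam δ)) (K := 2 * C) (by positivity)
    (by filter_upwards [self_mem_nhdsWithin] with δ hδ using (hP δ hδ).2)
    (fun f g hf hg => (hlimits f g hf hg).imp fun l h => h.1)
  obtain ⟨L, hL, hLlim⟩ := exists_weak_limit_pairing hV (l := 𝓝[>] (0 : ℝ))
    (T := fun ε : ℝ => weightedExtension V (freeResolvent (lam + s * ε * Complex.I)))
    (K := C) C.2
    (by filter_upwards [self_mem_nhdsWithin] with ε hε using (hR ε hε).2)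
    (fun f g hf hg => by
      obtain ⟨l, -, h⟩ := hlimits f g hf hg
      exact ⟨_, h⟩)
  obtain ⟨B, hB, hBr⟩ := hres'.exists_sphereRestrictionBound hV hn hlam
  -- Multiplying `c` by the factor `(2π)ⁿ 2√lam` between sphere integral and density leaves `s i π`,
  -- the coefficient of the density in the limit of the resolvents.
  set c : ℂ := s * ((2 * Real.pi : ℂ) ^ n)⁻¹ * (Complex.I * Real.pi / (2 * √lam)) with hc
  have hLeq : L = c • sphereConvCLM hV hB hBr + W := by
    refine clm_eq_of_pairing_eq hV fun f g hf hg => ?_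
    obtain ⟨l, h1, h2⟩ := hlimits f g hf hg
    rw [tendsto_nhds_unique (hLlim f g) h2, add_apply,
      smul_apply, pairing_eq_inner hV, inner_add_right, inner_smul_right,
      ← pairing_eq_inner, ← pairing_eq_inner, tendsto_nhds_unique (hW f g) h1,
      pairing_sphereConvCLM hV hB hBr hf hg, integral_sphereMeasure_eq_spectralDensity _ _ hlam]
    have h3 : (√lam : ℂ) ≠ 0 := by simpa using (Real.sqrt_pos.2 hlam).ne'
    have h4 : (2 * Real.pi : ℂ) ≠ 0 := by simp [Real.pi_ne_zero]
    rw [hc]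
    field_simp
  refine ⟨L, hLlim, hL, fun f => ⟨integrable_sphereMeasureHat_mul hV hB hBr f,
    memLp_sphereConv hV hB hBr f, W f, hW f, ?_⟩⟩
  rw [hLeq, add_apply, smul_apply]
  filter_upwards [Lp.coeFn_add (c • sphereConvCLM hV hB hBr f) (W f),
    Lp.coeFn_smul c (sphereConvCLM hV hB hBr f), coeFn_sphereConvCLM hV hB hBr f] with x h1 h2 h3
  rw [h1, Pi.add_apply, h2, Pi.smul_apply, h3, smul_eq_mul]
  rfl
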